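/- **Theorem (impact of uncertainty).** Let $(\widetilde\Omega,\widetilde{\mathcal F},\widetilde{\mathbb P},\mathbb D,\Gamma)$ be an error structure: a probability space, a dense vector subspace $\mathbb D\subset L^2(\widetilde{\mathbb P})$ containing the constant $1$, and a positive symmetric bilinear map $\Gamma:\mathbb D\times\mathbb D\to L^1(\widetilde{\mathbb P})$ such that for $\varphi,\psi:\mathbb R\to\mathbb R$ of class $C^1$ and Lipschitz and $u,v\in\mathbb D$ one has $\varphi(u),\psi(v)\in\mathbb D$ and $\Gamma[\varphi(u),\psi(v)]=\varphi'(u)\psi'(v)\Gamma[u,v]$ a.s., and such that the form $\mathcal E[u,v]=\frac12\widetilde{\mathbb E}[\Gamma[u,v]]$ is closed. Write $\Gamma[u]=\Gamma[u,u]$, and let $(A,\mathcal DA)$ be its generator: $u\in\mathcal DA$ and $A[u]=f\in L^2$ iff $u\in\mathbb D$ and $\mathcal E[u,v]=-\langle f,v\rangle_{L^2}$ for all $v\in\mathbb D$. If $Y=h(X)$ a.s. with $h:\mathbb R\to\mathbb R$ measurable and continuous at a point $x$ of the support of the law of $X$, write $Y|_{X=x}=h(x)$ (this does not depend on the choice of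 $h$). Let $X\in\mathcal DA$ be such that $0$ belongs to the support of the law of $X$ and $\Gamma[X]$, $A[X]$ are functions of $X$ that are continuous at $0$, with values $\gamma_0=\Gamma[X]|_{X=0}$ and $a_0=A[X]|_{X=0}$. Let $\sigma_0\in\mathbb R$, let $\sigma=\sigma_0+X$ be the uncertain parameter, and let $F:\mathbb R\to\mathbb R$ be of class $C^2$ with $$F(\sigma)\in L^2,\qquad F'(\sigma)^2\,\Gamma[X]\in L^1,\qquad F'(\sigma)A[X]+\tfrac12F''(\sigma)\Gamma[X]\in L^2,$$ and such that $F$ is square integrable with respect to some nondegenerate Gaussian law centred at $\sigma_0$. Let $G$ be a standard Gaussian variable on a probability space, independent of a given random element $W$ (which represents all the other random quantities). Then $F(\sigma)\in\mathcal DA$, and almost surely $$\Gamma[F(\sigma)]=F'(\sigma)^2\,\Gamma[X],\qquad A[F(\sigma)]=F'(\sigma)A[X]+\tfrac12F''(\sigma)\Gamma[X].$$ The values $\Gamma[F(\sigma)](\sigma_0)=\Gamma[F(\sigma)]|_{\sigma=\sigma_0}$ and $A[F(\sigma)](\sigma_0)=A[F(\sigma)]|_{\sigma=\sigma_0}$ exist,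 $\gamma_0\ge 0$, and $$\Gamma[F(\sigma)](\sigma_0)=F'(\sigma_0)^2\gamma_0,\qquad A[F(\sigma)](\sigma_0)=F'(\sigma_0)a_0+\tfrac12F''(\sigma_0)\gamma_0 .$$ Moreover, when the parameter $\sigma_0$ is replaced by the perturbed parameter $\sigma_\varepsilon=\sigma_0+\varepsilon a_0+\sqrt{\varepsilon\gamma_0}\,G$, the constant $F(\sigma_0)$ is turned into a random variable $F(\sigma_\varepsilon)$ which is approximately Gaussian, of the form $F(\sigma_0)+\varepsilon A[F(\sigma)](\sigma_0)+\sqrt\varepsilon\sqrt{\Gamma[F(\sigma)](\sigma_0)}\,G'$. Precisely, as $\varepsilon\downarrow0$, $F(\sigma_\varepsilon)$ is square integrable for all small $\varepsilon>0$ and 1. $\mathbb E[F(\sigma_\varepsilon)-F(\sigma_0)]=\varepsilon\,A[F(\sigma)](\sigma_0)+o(\varepsilon)$; 2. $\mathbb E[(F(\sigma_\varepsilon)-F(\sigma_0))^2]=\varepsilon\,\Gamma[F(\sigma)](\sigma_0)+o(\varepsilon)$ and $\operatorname{Var}F(\sigma_\varepsilon)=\varepsilon\,\Gamma[F(\sigma)](\sigma_0)+o(\varepsilon)$;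 3. there is a standard Gaussian variable $G'$ independent of $W$ (the same for all $\varepsilon$) such that $$Y_\varepsilon=F(\sigma_0)+\varepsilon\,A[F(\sigma)](\sigma_0)+\sqrt\varepsilon\,\sqrt{\Gamma[F(\sigma)](\sigma_0)}\;G'$$ has the law $\mathcal N\big(F(\sigma_0)+\varepsilon A[F(\sigma)](\sigma_0),\ \varepsilon\,\Gamma[F(\sigma)](\sigma_0)\big)$ for every $\varepsilon>0$, $\ \mathbb E[(F(\sigma_\varepsilon)-Y_\varepsilon)^2]=o(\varepsilon)$, and $\big(F(\sigma_\varepsilon)-F(\sigma_0)-\varepsilon A[F(\sigma)](\sigma_0)\big)/\sqrt\varepsilon$ converges in law to $\sqrt{\Gamma[F(\sigma)](\sigma_0)}\,G'$. -/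

import Mathlib

open MeasureTheory ProbabilityTheory Filter Topology Asymptotics
open scoped NNReal ENNReal

noncomputable section

/-- An error structure `(Ω, 𝓕, P, 𝔻, Γ)` on the probability space `(Ω, 𝓕, P)`: a dense vector
subspace `𝔻` of `L²(P)` and a positive symmetric bilinear carré du champ operator
`Γ : 𝔻 × 𝔻 → L¹(P)` which satisfies the functional calculus of class `C¹ ∩ Lip`, such that the
form `𝓔[u, v] = ½ E[Γ[u, v]]` is closed and the constant function `1` belongs to `𝔻`. -/
structure ErrorStructure {Ω : Type*} [MeasurableSpace Ω] (P : Measure Ω)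
    [IsProbabilityMeasure P] where
  /-- the domain `𝔻` -/
  D : Submodule ℝ (Lp ℝ 2 P)
  /-- the carré du champ operator -/
  Γ : D →ₗ[ℝ] D →ₗ[ℝ] Lp ℝ 1 P
  dense : Dense (D : Set (Lp ℝ 2 P))
  symm : ∀ u v : D, Γ u v = Γ v u
  nonneg : ∀ u : D, ∀ᵐ ω ∂P, 0 ≤ Γ u u ω
  functional_calculus : ∀ F H : ℝ → ℝ, ContDiff ℝ 1 F → (∃ K, LipschitzWith K F) →
    ContDiff ℝ 1 H → (∃ K, LipschitzWith K H) → ∀ u v : D, ∃ Fu Hv : D,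
      (∀ᵐ ω ∂P, (Fu : Lp ℝ 2 P) ω = F ((u : Lp ℝ 2 P) ω)) ∧
      (∀ᵐ ω ∂P, (Hv : Lp ℝ 2 P) ω = H ((v : Lp ℝ 2 P) ω)) ∧
      ∀ᵐ ω ∂P, Γ Fu Hv ω =
        deriv F ((u : Lp ℝ 2 P) ω) * deriv H ((v : Lp ℝ 2 P) ω) * Γ u v ω
  /-- `𝔻` is complete for the norm `(‖u‖² + 𝓔[u, u])^(1/2)` -/
  closed : ∀ u : ℕ → D, CauchySeq (fun n => (u n : Lp ℝ 2 P)) →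
    Tendsto (fun p : ℕ × ℕ => (1 / 2 : ℝ) * ∫ ω, Γ (u p.1 - u p.2) (u p.1 - u p.2) ω ∂P)
      atTop (𝓝 0) →
    ∃ w : D, Tendsto (fun n => (u n : Lp ℝ 2 P)) atTop (𝓝 (w : Lp ℝ 2 P)) ∧
      Tendsto (fun n => (1 / 2 : ℝ) * ∫ ω, Γ (u n - w) (u n - w) ω ∂P) atTop (𝓝 0)
  one_mem : ∃ e : D, ∀ᵐ ω ∂P, (e : Lp ℝ 2 P) ω = 1

namespace ErrorStructure

variable {Ω : Type*} [MeasurableSpace Ω] {P : Measure Ω} [IsProbabilityMeasure P]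

/-- The Dirichlet form `𝓔[u, v] = ½ E[Γ[u, v]]`. -/
def energy (S : ErrorStructure P) (u v : S.D) : ℝ := (1 / 2 : ℝ) * ∫ ω, S.Γ u v ω ∂P

lemma energy_add (S : ErrorStructure P) (u u' v : S.D) :
    S.energy (u + u') v = S.energy u v + S.energy u' v := by
  unfold energy
  rw [map_add, LinearMap.add_apply, integral_congr_ae (Lp.coeFn_add _ _)]
  simp only [Pi.add_apply]
  rw [integral_add (L1.integrable_coeFn _) (L1.integrable_coeFn _)]
  ring

lemma energy_smul (S : ErrorStructure P) (c : ℝ) (u v : S.D) :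
    S.energy (c • u) v = c * S.energy u v := by
  unfold energy
  rw [map_smul, LinearMap.smul_apply, integral_congr_ae (Lp.coeFn_smul _ _)]
  simp only [Pi.smul_apply, smul_eq_mul]
  rw [integral_const_mul]
  ring

/-- The graph of the generator: the pairs `(u, f)` in `L² × L²` with `u ∈ 𝔻` and
`𝓔[u, v] = -⟨f, v⟩` for all `v ∈ 𝔻`. -/
def generatorGraph (S : ErrorStructure P) : Submodule ℝ (Lp ℝ 2 P × Lp ℝ 2 P) where
  carrier := {p | ∃ h : p.1 ∈ S.D, ∀ v : S.D,
    S.energy ⟨p.1, h⟩ v = -inner ℝ p.2 (v : Lp ℝ 2 P)}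
  add_mem' := by
    rintro p q ⟨hp, hp'⟩ ⟨hq, hq'⟩
    refine ⟨S.D.add_mem hp hq, fun v => ?_⟩
    have := S.energy_add ⟨p.1, hp⟩ ⟨q.1, hq⟩ v
    rw [hp', hq'] at this
    simp only [Prod.snd_add, inner_add_left, neg_add]
    exact this
  zero_mem' := by
    refine ⟨S.D.zero_mem, fun v => ?_⟩
    have := S.energy_smul 0 0 v
    rw [zero_mul, smul_zero] at this
    simp only [Prod.snd_zero, inner_zero_left, neg_zero]
    exact this
  smul_mem' := by
    rintro c p ⟨hp, hp'⟩
    refine ⟨S.D.smul_mem c hp, fun v => ?_⟩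
    have := S.energy_smul c ⟨p.1, hp⟩ v
    rw [hp'] at this
    simp only [Prod.smul_snd, real_inner_smul_left]
    rw [← mul_neg]
    exact this

lemma generatorGraph_single (S : ErrorStructure P) (p : Lp ℝ 2 P × Lp ℝ 2 P)
    (hp : p ∈ S.generatorGraph) (h0 : p.1 = 0) : p.2 = 0 := by
  obtain ⟨h, hv⟩ := hp
  refine S.dense.eq_zero_of_inner_left (𝕜 := ℝ) fun v hvD => ?_
  have h1 := hv ⟨v, hvD⟩
  have h2 := S.energy_smul 0 0 ⟨v, hvD⟩
  rw [zero_mul, smul_zero] at h2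
  have h3 : (⟨p.1, h⟩ : S.D) = 0 := Subtype.ext h0
  rw [h3, h2] at h1
  exact neg_eq_zero.1 h1.symm

/-- The generator `(A, 𝓓A)` of the error structure: the self-adjoint operator on `L²(P)` that is
associated with the closed form `𝓔`, which is the generator of the strongly continuous contraction
semigroup of the error structure. -/
def generator (S : ErrorStructure P) : Lp ℝ 2 P →ₗ.[ℝ] Lp ℝ 2 P := S.generatorGraph.toLinearPMap

lemma mem_generatorGraph_iff (S : ErrorStructure P) (u f : Lp ℝ 2 P) :
    (u, f) ∈ S.generatorGraph ↔ ∃ h : u ∈ S.generator.domain, S.generator ⟨u, h⟩ = f := by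
  have key := Submodule.toLinearPMap_graph_eq S.generatorGraph S.generatorGraph_single
  rw [← key, LinearPMap.mem_graph_iff]
  constructor
  · rintro ⟨⟨y, hy⟩, rfl, h⟩
    exact ⟨hy, h⟩
  · rintro ⟨h, h'⟩
    exact ⟨⟨u, h⟩, rfl, h'⟩

end ErrorStructure

/-- `Y` is a function of the random variable `X` which is continuous at `x`, and has there the
value `y`: there is a function `h` with `Y = h(X)` almost surely, continuous at `x`, and
`h(x) = y`. This is what `Y|_{X = x} = y` means. -/
def HasValueAt {Ω : Type*} [MeasurableSpace Ω] (P : Measure Ω) (Y X : Ω → ℝ) (x y : ℝ) : Prop :=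
  ∃ h : ℝ → ℝ, Measurable h ∧ ContinuousAt h x ∧ (∀ᵐ ω ∂P, Y ω = h (X ω)) ∧ h x = y

/-- The value is unique at every point of the support of the law of `X`. -/
lemma HasValueAt.unique {Ω : Type*} [MeasurableSpace Ω] {P : Measure Ω} {Y X : Ω → ℝ}
    {x y y' : ℝ} (hX : AEMeasurable X P) (hx : x ∈ (P.map X).support)
    (h : HasValueAt P Y X x y) (h' : HasValueAt P Y X x y') : y = y' := by
  obtain ⟨f, hfm, hfc, hf, rfl⟩ := h
  obtain ⟨g, hgm, hgc, hg, rfl⟩ := h'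
  by_contra hne
  have hU : {z | f z = g z}ᶜ ∈ 𝓝 x :=
    (hfc.prodMk hgc).eventually (isClosed_diagonal.isOpen_compl.mem_nhds hne)
  have hpos := (Measure.mem_support_iff_forall x).1 hx _ hU
  rw [Measure.map_apply_of_aemeasurable hX
    (measurableSet_eq_fun hfm hgm).compl] at hpos
  refine hpos.ne' (measure_eq_zero_iff_ae_notMem.2 ?_)
  filter_upwards [hf, hg] with ω h1 h2
  simp [← h1, ← h2]

end

/-! Two independent facts are combined: a chain rule in the error structure, and a Taylor expansion
under a Gaussian law that concentrates at `σ₀`. They meet only through the coefficients `γ₀` and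
`a₀`.

Chain rule for `Γ`. The axioms give it for `C¹` Lipschitz functions. A general `F` is approximated
by such functions `f n`, with `|f n| ≤ |F|` and `|(f n)'| ≤ |F'| + C`. Since `Γ[f p(X) - f q(X)] =
((f p)' - (f q)')²(X) Γ[X]`, dominated convergence makes `f n(X)` Cauchy in energy, closedness puts
the limit `F(X)` in `𝔻`, and Cauchy–Schwarz for `Γ` passes the formula to the limit (`exists_comp`).

Chain rule for `A`. Formally, testing `X` against `F'(X) v` gives `Γ[X, F'(X) v] = Γ[F(X), v] + v
F''(X) Γ[X]`, and integration turns `𝓔[X, F'(X) v] = -⟨A[X], F'(X) v⟩` into `𝓔[F(X), v] = -⟨F'(X)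
A[X] + ½ F''(X) Γ[X], v⟩`. As `F'(X) v` need not lie in `𝔻`, `F'` is cut off and `v` is first taken
bounded (`comp_mem_generatorGraph`).

Gaussian expansion. The law of `σ_ε` has first and second moments `ε a₀` and `ε γ₀ + ε² a₀²` about
`σ₀`. Any `H = o((y - σ₀)²)` that is integrable for one nondegenerate Gaussian law centred at `σ₀`
integrates to `o(ε)`: near `σ₀` by the second moment, far away because the Gaussian tails are
exponentially small in `1/ε` relative to the fixed law (`gaussianReal_integral_isLittleO`). Applied
to Taylor remainders, this gives the bias, the quadratic error and the approximation by a Gaussian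
variable, with `G' = ±G`, the sign being that of `F'(σ₀)`. -/

/-! ### Cutoffs and smooth truncations on the line. -/

lemma exists_seq_cutoff : ∃ (χ : ℕ → ℝ → ℝ) (C : ℝ), 0 ≤ C ∧
    (∀ n, ContDiff ℝ 1 (χ n)) ∧ (∀ n, HasCompactSupport (χ n)) ∧ (∀ n x, |χ n x| ≤ 1) ∧
    (∀ n x, |deriv (χ n) x| ≤ C / (n + 1)) ∧ ∀ x, Tendsto (fun n => χ n x) atTop (𝓝 1) := by
  obtain ⟨b, hb, hbc, hb0, hb1, hbe⟩ : ∃ b : ℝ → ℝ, ContDiff ℝ 1 b ∧ HasCompactSupport b ∧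
      (∀ x, 0 ≤ b x) ∧ (∀ x, b x ≤ 1) ∧ b 0 = 1 := by
    have b : ContDiffBump (0 : ℝ) := ⟨1, 2, one_pos, one_lt_two⟩
    exact ⟨b, b.contDiff, b.hasCompactSupport, fun _ => b.nonneg, fun _ => b.le_one,
      b.one_of_mem_closedBall (by simp [b.rIn_pos.le])⟩
  have hd : Continuous (deriv b) := hb.continuous_deriv le_rfl
  have hbc' : HasCompactSupport (deriv b) := hbc.deriv
  obtain ⟨C, hC⟩ : ∃ C, ∀ x, ‖deriv b x‖ ≤ C := hbc'.exists_bound_of_continuous hd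
  have hpos : ∀ n : ℕ, (0 : ℝ) < n + 1 := fun n => by positivity
  refine ⟨fun n x => b (((n : ℝ) + 1)⁻¹ * x), C, (norm_nonneg _).trans (hC 0), fun n => ?_,
    fun n => ?_, fun n x => ?_, fun n x => ?_, fun x => ?_⟩
  · exact hb.comp (contDiff_const.mul contDiff_id)
  · exact hbc.comp_homeomorph (Homeomorph.mulLeft₀ _ (inv_ne_zero (hpos n).ne'))
  · rw [abs_of_nonneg (hb0 _)]
    exact hb1 _
  · have h := deriv_comp_mul_left ((n : ℝ) + 1)⁻¹ b x
    rw [h, smul_eq_mul, abs_mul, abs_of_pos (inv_pos.2 (hpos n)), div_eq_inv_mul]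
    exact mul_le_mul_of_nonneg_left (hC _) (inv_pos.2 (hpos n)).le
  · have h1 : Tendsto (fun n : ℕ => ((n : ℝ) + 1)⁻¹ * x) atTop (𝓝 0) := by
      simpa using (tendsto_one_div_add_atTop_nhds_zero_nat (𝕜 := ℝ)).mul_const x
    have h2 := (hb.continuous.tendsto 0).comp h1
    rwa [hbe] at h2

/-- This is the difference quotient at `0` of `t ↦ arctan (t y)`, with step `1 / (n + 1)`. The map
`y ↦ c arctan (y / c)` serves as a smooth truncation: bounded, 1-Lipschitz, dominated by `|y|`, and
tending to the identity as `c` grows. -/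
lemma tendsto_mul_arctan_div (y : ℝ) :
    Tendsto (fun n : ℕ => ((n : ℝ) + 1) * Real.arctan (y / (n + 1))) atTop (𝓝 y) := by
  have h := (Real.hasDerivAt_arctan 0).comp_of_eq (0 : ℝ)
    ((hasDerivAt_id (0 : ℝ)).mul_const y) (by simp)
  have h1 := h.tendsto_slope
  have h2 : Tendsto (fun n : ℕ => 1 / ((n : ℝ) + 1)) atTop (𝓝[≠] 0) :=
    tendsto_nhdsWithin_iff.2 ⟨tendsto_one_div_add_atTop_nhds_zero_nat,
      Eventually.of_forall fun n => by
        have : (0 : ℝ) < n + 1 := by positivity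
        simpa using this.ne'⟩
  have h3 := h1.comp h2
  simp only [Function.comp_def, slope_def_field] at h3
  norm_num at h3
  convert h3 using 2 with n
  rw [div_eq_inv_mul, mul_comm]

lemma hasDerivAt_mul_arctan_div {c : ℝ} (hc : c ≠ 0) (y : ℝ) :
    HasDerivAt (fun y => c * Real.arctan (y / c)) (1 / (1 + (y / c) ^ 2)) y := by
  have h := ((Real.hasDerivAt_arctan (y / c)).comp y ((hasDerivAt_id y).div_const c)).const_mul c
  exact h.congr_deriv (by field_simp)

lemma contDiff_mul_arctan_div (c : ℝ) :
    ContDiff ℝ 1 (fun y => c * Real.arctan (y / c)) :=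
  contDiff_const.mul (Real.contDiff_arctan.comp (contDiff_id.div_const c))

lemma abs_one_div_one_add_sq_le (z : ℝ) : |1 / (1 + z ^ 2)| ≤ 1 := by
  rw [abs_of_nonneg (by positivity), div_le_one (by positivity)]
  nlinarith [sq_nonneg z]

lemma lipschitzWith_mul_arctan_div {c : ℝ} (hc : c ≠ 0) :
    LipschitzWith 1 (fun y => c * Real.arctan (y / c)) :=
  lipschitzWith_of_nnnorm_deriv_le (fun y => (hasDerivAt_mul_arctan_div hc y).differentiableAt)
    fun y => by
      rw [(hasDerivAt_mul_arctan_div hc y).deriv, ← NNReal.coe_le_coe, coe_nnnorm]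
      exact abs_one_div_one_add_sq_le _

lemma abs_mul_arctan_div_le {c : ℝ} (hc : c ≠ 0) (y : ℝ) : |c * Real.arctan (y / c)| ≤ |y| := by
  have := (lipschitzWith_mul_arctan_div hc).dist_le_mul y 0
  simpa [Real.dist_eq] using this

lemma abs_mul_arctan_div_le_const {c : ℝ} (hc : 0 < c) (y : ℝ) :
    |c * Real.arctan (y / c)| ≤ 2 * c := by
  rw [abs_mul, abs_of_pos hc, mul_comm]
  refine mul_le_mul_of_nonneg_right ?_ hc.le
  rw [abs_le]
  constructor <;> linarith [Real.neg_pi_div_two_lt_arctan (y / c),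
    Real.arctan_lt_pi_div_two (y / c), Real.pi_le_four]

/-- A function of class `C¹` is the limit of Lipschitz functions of class `C¹` which it dominates,
whose derivatives converge and are dominated up to a constant. -/
lemma exists_seq_lipschitz_approx {F : ℝ → ℝ} (hF : ContDiff ℝ 1 F) :
    ∃ (f : ℕ → ℝ → ℝ) (C : ℝ), 0 ≤ C ∧ (∀ n, ContDiff ℝ 1 (f n)) ∧
      (∀ n, ∃ K, LipschitzWith K (f n)) ∧ (∀ n x, |f n x| ≤ |F x|) ∧
      (∀ n x, |deriv (f n) x| ≤ |deriv F x| + C) ∧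
      (∀ x, Tendsto (fun n => f n x) atTop (𝓝 (F x))) ∧
      ∀ x, Tendsto (fun n => deriv (f n) x) atTop (𝓝 (deriv F x)) := by
  obtain ⟨χ, C, hC, hχ, hχc, hχ1, hχd, hχt⟩ := exists_seq_cutoff
  -- The truncated `F` is bounded by `2 (n + 1)`, so the cutoff must have slope of order `(n + 1)⁻²`
  -- for its derivative to contribute only `O(1 / n)`.
  let k : ℕ → ℕ := fun n => (n + 1) ^ 2
  have hk : Tendsto k atTop atTop :=
    tendsto_atTop_mono (fun n => by simp only [k, id]; nlinarith) tendsto_id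
  have hpos : ∀ n : ℕ, (0 : ℝ) < n + 1 := fun n => by positivity
  let p : ℕ → ℝ → ℝ := fun n x => ((n : ℝ) + 1) * Real.arctan (F x / (n + 1))
  have hp : ∀ n, ContDiff ℝ 1 (p n) := fun n => (contDiff_mul_arctan_div _).comp hF
  have hpd : ∀ n x, HasDerivAt (p n) (1 / (1 + (F x / (n + 1)) ^ 2) * deriv F x) x := fun n x =>
    (hasDerivAt_mul_arctan_div (hpos n).ne' (F x)).comp x
      (hF.differentiable one_ne_zero x).hasDerivAt
  have hd : ∀ n x, deriv (fun x => χ (k n) x * p n x) x =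
      deriv (χ (k n)) x * p n x + χ (k n) x * (1 / (1 + (F x / (n + 1)) ^ 2) * deriv F x) :=
    fun n x => (((hχ _).differentiable one_ne_zero x).hasDerivAt.mul (hpd n x)).deriv
  have hsmall : ∀ n x, |deriv (χ (k n)) x * p n x| ≤ 2 * C / (n + 1) := fun n x => by
    rw [abs_mul]
    calc _ ≤ C / ((k n : ℕ) + 1) * (2 * ((n : ℝ) + 1)) :=
          mul_le_mul (hχd _ _) (abs_mul_arctan_div_le_const (hpos n) _) (abs_nonneg _)
            (by positivity)
      _ ≤ C / ((n : ℝ) + 1) ^ 2 * (2 * ((n : ℝ) + 1)) := by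
          gcongr
          simp only [k]; push_cast; linarith
      _ = 2 * C / (n + 1) := by
          have := (hpos n).ne'
          field_simp
  refine ⟨fun n x => χ (k n) x * p n x, 2 * C, by positivity, fun n => (hχ _).mul (hp n),
    fun n => ?_, fun n x => ?_, fun n x => ?_, fun x => ?_, fun x => ?_⟩
  · exact ⟨_, ((hχ _).mul (hp n)).lipschitzWith_of_hasCompactSupport ((hχc _).mul_right)
      one_ne_zero |>.choose_spec⟩
  · rw [abs_mul]
    calc _ ≤ 1 * |F x| := mul_le_mul (hχ1 _ _) (abs_mul_arctan_div_le (hpos n).ne' _)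
            (abs_nonneg _) zero_le_one
      _ = _ := one_mul _
  · rw [hd, add_comm]
    refine (abs_add_le _ _).trans (add_le_add ?_ ((hsmall n x).trans ?_))
    · rw [abs_mul, abs_mul]
      calc _ ≤ 1 * (1 * |deriv F x|) := by
            gcongr
            · exact hχ1 _ _
            · exact abs_one_div_one_add_sq_le _
        _ = _ := by ring
    · exact div_le_self (by positivity) (by linarith [n.cast_nonneg (α := ℝ)])
  · simpa using ((hχt x).comp hk).mul (tendsto_mul_arctan_div (F x))
  · simp only [hd]
    have h1 : Tendsto (fun n => deriv (χ (k n)) x * p n x) atTop (𝓝 0) := by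
      refine squeeze_zero_norm (fun n => hsmall n x) ?_
      have := (tendsto_one_div_add_atTop_nhds_zero_nat (𝕜 := ℝ)).const_mul (2 * C)
      simpa [div_eq_mul_inv] using this
    have h2 : Tendsto (fun n : ℕ => F x / ((n : ℝ) + 1)) atTop (𝓝 0) := by
      have := (tendsto_one_div_add_atTop_nhds_zero_nat (𝕜 := ℝ)).const_mul (F x)
      simpa [div_eq_mul_inv] using this
    have h3 : Tendsto (fun n : ℕ => 1 / (1 + (F x / ((n : ℝ) + 1)) ^ 2)) atTop (𝓝 1) := by
      have := ((h2.pow 2).const_add 1).inv₀ (by norm_num)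
      simpa using this
    simpa using h1.add (((hχt x).comp hk).mul (h3.mul_const (deriv F x)))

/-! ### Functional calculus in the domain of the form. -/

namespace ErrorStructure

variable {Ω : Type*} [MeasurableSpace Ω] {P : Measure Ω} [IsProbabilityMeasure P]

lemma eq_of_ae_eq (S : ErrorStructure P) {u v : S.D}
    (h : ∀ᵐ ω ∂P, (u : Lp ℝ 2 P) ω = (v : Lp ℝ 2 P) ω) : u = v :=
  Subtype.ext (Lp.ext h)

/-- The second function of the functional calculus is taken to be the identity. The element
representing `φ(u)` supplied there may depend on `v`; almost sure equality shows that a single one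
serves for all `v`. -/
lemma exists_lipschitz_comp (S : ErrorStructure P) {φ : ℝ → ℝ} (hφ : ContDiff ℝ 1 φ)
    (hφ' : ∃ K, LipschitzWith K φ) (u : S.D) :
    ∃ w : S.D, (∀ᵐ ω ∂P, (w : Lp ℝ 2 P) ω = φ ((u : Lp ℝ 2 P) ω)) ∧
      ∀ v : S.D, ∀ᵐ ω ∂P, S.Γ w v ω = deriv φ ((u : Lp ℝ 2 P) ω) * S.Γ u v ω := by
  have key := fun v => S.functional_calculus φ id hφ hφ' contDiff_id ⟨1, LipschitzWith.id⟩ u v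
  obtain ⟨w, -, hw, -⟩ := key u
  refine ⟨w, hw, fun v => ?_⟩
  obtain ⟨w', v', hw', hv', h⟩ := key v
  obtain rfl : w' = w := S.eq_of_ae_eq (by filter_upwards [hw, hw'] with ω h1 h2; rw [h1, h2])
  obtain rfl : v' = v := S.eq_of_ae_eq hv'
  filter_upwards [h] with ω h
  simpa [deriv_id] using h

lemma integrable_Γ (S : ErrorStructure P) (u v : S.D) : Integrable (S.Γ u v) P :=
  L1.integrable_coeFn _

lemma Γ_add_left (S : ErrorStructure P) (u u' v : S.D) :
    ∀ᵐ ω ∂P, S.Γ (u + u') v ω = S.Γ u v ω + S.Γ u' v ω := by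
  rw [map_add, LinearMap.add_apply]
  exact Lp.coeFn_add _ _

lemma Γ_sub_left (S : ErrorStructure P) (u u' v : S.D) :
    ∀ᵐ ω ∂P, S.Γ (u - u') v ω = S.Γ u v ω - S.Γ u' v ω := by
  rw [map_sub, LinearMap.sub_apply]
  exact Lp.coeFn_sub _ _

lemma Γ_smul_left (S : ErrorStructure P) (c : ℝ) (u v : S.D) :
    ∀ᵐ ω ∂P, S.Γ (c • u) v ω = c * S.Γ u v ω := by
  rw [map_smul, LinearMap.smul_apply]
  exact Lp.coeFn_smul _ _

lemma Γ_smul_add_self (S : ErrorStructure P) (c : ℝ) (u v : S.D) :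
    ∀ᵐ ω ∂P, S.Γ (c • u + v) (c • u + v) ω =
      c ^ 2 * S.Γ u u ω + 2 * c * S.Γ u v ω + S.Γ v v ω := by
  have e1 := S.Γ_add_left (c • u) v (c • u + v)
  have e2 := S.Γ_smul_left c u (c • u + v)
  have e3 := S.Γ_add_left (c • u) v u
  have e4 := S.Γ_add_left (c • u) v v
  have e5 := S.Γ_smul_left c u u
  have e6 := S.Γ_smul_left c u v
  rw [S.symm u (c • u + v)] at e2
  rw [S.symm v (c • u + v)] at e1
  rw [S.symm v u] at e3
  filter_upwards [e1, e2, e3, e4, e5, e6] with ω e1 e2 e3 e4 e5 e6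
  rw [e1, e2, e3, e4, e5, e6]
  ring

/-- The Cauchy–Schwarz inequality for the carré du champ. -/
lemma sq_integral_abs_Γ_le (S : ErrorStructure P) (u v : S.D) :
    (∫ ω, |S.Γ u v ω| ∂P) ^ 2 ≤ (∫ ω, S.Γ u u ω ∂P) * ∫ ω, S.Γ v v ω ∂P := by
  have hC : 0 ≤ ∫ ω, |S.Γ u v ω| ∂P := integral_nonneg fun _ => abs_nonneg _
  have hA : 0 ≤ ∫ ω, S.Γ u u ω ∂P := integral_nonneg_of_ae (S.nonneg u)
  have hB : 0 ≤ ∫ ω, S.Γ v v ω ∂P := integral_nonneg_of_ae (S.nonneg v)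
  have key : ∀ t : ℝ, 0 ≤ (∫ ω, S.Γ u u ω ∂P) * (t * t) +
      (-(2 * ∫ ω, |S.Γ u v ω| ∂P)) * t + ∫ ω, S.Γ v v ω ∂P := by
    intro t
    rcases le_total t 0 with ht | ht
    · have := mul_nonneg hA (mul_self_nonneg t)
      nlinarith
    -- Positivity of `Γ` at both `t u + v` and `-t u + v` is what puts the absolute value inside the
    -- integral.
    have hle : ∀ᵐ ω ∂P, 2 * t * |S.Γ u v ω| ≤ t ^ 2 * S.Γ u u ω + S.Γ v v ω := by
      filter_upwards [S.Γ_smul_add_self t u v, S.Γ_smul_add_self (-t) u v,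
        S.nonneg (t • u + v), S.nonneg (-t • u + v)] with ω h1 h2 h3 h4
      rw [h1] at h3
      rw [h2] at h4
      rcases abs_cases (S.Γ u v ω) with h | h <;> rw [h.1] <;> nlinarith
    have := integral_mono_ae ((S.integrable_Γ u v).abs.const_mul (2 * t))
      (((S.integrable_Γ u u).const_mul (t ^ 2)).add (S.integrable_Γ v v)) hle
    simp only [Pi.add_apply] at this
    rw [integral_const_mul, integral_add ((S.integrable_Γ u u).const_mul _) (S.integrable_Γ v v),
      integral_const_mul] at this
    nlinarith
  have := discrim_le_zero key
  rw [discrim] at this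
  nlinarith

/-- By Cauchy–Schwarz, convergence in energy makes `Γ[u n, v]` converge in `L¹`, hence almost surely
along a subsequence, which identifies the pointwise limit. -/
lemma Γ_eq_of_tendsto (S : ErrorStructure P) {u : ℕ → S.D} {w : S.D}
    (hu : Tendsto (fun n => (1 / 2 : ℝ) * ∫ ω, S.Γ (u n - w) (u n - w) ω ∂P) atTop (𝓝 0))
    (v : S.D) {g : Ω → ℝ} (hg : ∀ᵐ ω ∂P, Tendsto (fun n => S.Γ (u n) v ω) atTop (𝓝 (g ω))) :
    ∀ᵐ ω ∂P, S.Γ w v ω = g ω := by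
  have h1 : Tendsto (fun n => S.Γ (u n) v) atTop (𝓝 (S.Γ w v)) := by
    rw [tendsto_iff_norm_sub_tendsto_zero]
    have h2 : Tendsto (fun n => √((∫ ω, S.Γ (u n - w) (u n - w) ω ∂P) * ∫ ω, S.Γ v v ω ∂P))
        atTop (𝓝 0) := by
      have := ((hu.const_mul 2).mul_const (∫ ω, S.Γ v v ω ∂P)).sqrt
      simpa using this
    refine squeeze_zero (fun _ => norm_nonneg _) (fun n => ?_) h2
    rw [← LinearMap.sub_apply, ← map_sub, L1.norm_eq_integral_norm]
    exact Real.le_sqrt_of_sq_le (S.sq_integral_abs_Γ_le _ _)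
  obtain ⟨ns, hns, hae⟩ := (tendstoInMeasure_of_tendsto_Lp h1).exists_seq_tendsto_ae
  filter_upwards [hae, hg] with ω h2 h3
  exact tendsto_nhds_unique h2 (h3.comp hns.tendsto_atTop)

/-- The functional calculus for a function of class `C¹`, as soon as it makes sense. -/
theorem exists_comp (S : ErrorStructure P) {F : ℝ → ℝ} (hF : ContDiff ℝ 1 F) (u : S.D)
    (hF0 : MemLp (fun ω => F ((u : Lp ℝ 2 P) ω)) 2 P)
    (hF1 : Integrable (fun ω => deriv F ((u : Lp ℝ 2 P) ω) ^ 2 * S.Γ u u ω) P) :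
    ∃ w : S.D, (∀ᵐ ω ∂P, (w : Lp ℝ 2 P) ω = F ((u : Lp ℝ 2 P) ω)) ∧
      ∀ v : S.D, ∀ᵐ ω ∂P, S.Γ w v ω = deriv F ((u : Lp ℝ 2 P) ω) * S.Γ u v ω := by
  obtain ⟨f, C, hC, hf, hfL, hfF, hfd, hft, hfdt⟩ := exists_seq_lipschitz_approx hF
  choose w hw hwΓ using fun n => S.exists_lipschitz_comp (hf n) (hfL n) u
  have hum : AEStronglyMeasurable (u : Lp ℝ 2 P) P := (Lp.memLp _).1
  have hlim : Tendsto (fun n => (w n : Lp ℝ 2 P)) atTop (𝓝 hF0.toLp) := by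
    have hint : Tendsto (fun n => ∫ ω, (f n ((u : Lp ℝ 2 P) ω) - F ((u : Lp ℝ 2 P) ω)) ^ 2 ∂P)
        atTop (𝓝 (∫ _, (0 : ℝ) ∂P)) := by
      refine tendsto_integral_of_dominated_convergence
        (fun ω => 4 * F ((u : Lp ℝ 2 P) ω) ^ 2) (fun n => ?_) (hF0.integrable_sq.const_mul 4)
        (fun n => Eventually.of_forall fun ω => ?_) (Eventually.of_forall fun ω => ?_)
      · exact ((((hf n).continuous.comp_aestronglyMeasurable hum).sub
          (hF.continuous.comp_aestronglyMeasurable hum)).pow 2)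
      · rw [Real.norm_of_nonneg (sq_nonneg _)]
        have := hfF n ((u : Lp ℝ 2 P) ω)
        have h2 := abs_sub (f n ((u : Lp ℝ 2 P) ω)) (F ((u : Lp ℝ 2 P) ω))
        have h3 : |f n ((u : Lp ℝ 2 P) ω) - F ((u : Lp ℝ 2 P) ω)|
          ≤ |2 * F ((u : Lp ℝ 2 P) ω)| := by rw [abs_mul, abs_two]; linarith
        have := sq_le_sq.2 h3
        linarith
      · have := ((hft ((u : Lp ℝ 2 P) ω)).sub_const (F ((u : Lp ℝ 2 P) ω))).pow 2
        simpa using this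
    rw [tendsto_iff_norm_sub_tendsto_zero]
    have h2 := hint.sqrt
    simp only [integral_zero, Real.sqrt_zero] at h2
    refine h2.congr fun n => ?_
    rw [Real.sqrt_eq_iff_eq_sq (integral_nonneg fun _ => sq_nonneg _) (norm_nonneg _),
      ← real_inner_self_eq_norm_sq, L2.inner_def]
    refine integral_congr_ae ?_
    filter_upwards [hw n, hF0.coeFn_toLp, Lp.coeFn_sub (w n : Lp ℝ 2 P) hF0.toLp] with ω h1 h2 h3
    rw [h3, Pi.sub_apply, h1, h2]
    simp [sq]
  -- The integrand is `((f p)' - (f q)')²(u) Γ[u]`, dominated by `4 (|F'| + C)² Γ[u] ≤ 8 (F'² + C²)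
  -- Γ[u]`.
  have henergy : Tendsto (fun p : ℕ × ℕ => (1 / 2 : ℝ) *
      ∫ ω, S.Γ (w p.1 - w p.2) (w p.1 - w p.2) ω ∂P) atTop (𝓝 0) := by
    have hint : Tendsto (fun p : ℕ × ℕ => ∫ ω, (deriv (f p.1) ((u : Lp ℝ 2 P) ω) -
        deriv (f p.2) ((u : Lp ℝ 2 P) ω)) ^ 2 * S.Γ u u ω ∂P) atTop (𝓝 (∫ _, (0 : ℝ) ∂P)) := by
      refine tendsto_integral_filter_of_dominated_convergence
        (fun ω => 8 * (deriv F ((u : Lp ℝ 2 P) ω) ^ 2 * S.Γ u u ω) + 8 * C ^ 2 * S.Γ u u ω)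
        (Eventually.of_forall fun p => ?_) (Eventually.of_forall fun p => ?_)
        ((hF1.const_mul 8).add ((S.integrable_Γ u u).const_mul _))
        (Eventually.of_forall fun ω => ?_)
      · exact (((((hf _).continuous_deriv le_rfl).comp_aestronglyMeasurable hum).sub
          (((hf _).continuous_deriv le_rfl).comp_aestronglyMeasurable hum)).pow 2).mul
          (S.integrable_Γ u u).1
      · filter_upwards [S.nonneg u] with ω hω
        rw [Real.norm_of_nonneg (mul_nonneg (sq_nonneg _) hω), ← mul_assoc, ← add_mul]
        refine mul_le_mul_of_nonneg_right ?_ hω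
        set x := (u : Lp ℝ 2 P) ω
        have h1 := hfd p.1 x
        have h2 := hfd p.2 x
        have h3 : |deriv (f p.1) x - deriv (f p.2) x| ≤ 2 * (|deriv F x| + C) :=
          (abs_sub _ _).trans (by linarith)
        have h4 := pow_le_pow_left₀ (abs_nonneg _) h3 2
        rw [sq_abs] at h4
        have h5 := sq_abs (deriv F x)
        nlinarith [sq_nonneg (|deriv F x| - C)]
      · rw [← prod_atTop_atTop_eq]
        have h1 := (hfdt ((u : Lp ℝ 2 P) ω)).comp (tendsto_fst (g := (atTop : Filter ℕ)))
        have h2 := (hfdt ((u : Lp ℝ 2 P) ω)).comp (tendsto_snd (f := (atTop : Filter ℕ)))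
        have := ((h1.sub h2).pow 2).mul_const (S.Γ u u ω)
        simpa using this
    have h2 := hint.const_mul (1 / 2 : ℝ)
    simp only [integral_zero, mul_zero] at h2
    refine h2.congr fun p => ?_
    congr 1
    refine integral_congr_ae ?_
    have e1 := S.Γ_sub_left (w p.1) (w p.2) (w p.1 - w p.2)
    have e2 := hwΓ p.1 (w p.1 - w p.2)
    have e3 := hwΓ p.2 (w p.1 - w p.2)
    have e4 := S.Γ_sub_left (w p.1) (w p.2) u
    have e5 := hwΓ p.1 u
    have e6 := hwΓ p.2 u
    rw [S.symm u] at e2 e3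
    filter_upwards [e1, e2, e3, e4, e5, e6] with ω e1 e2 e3 e4 e5 e6
    rw [e1, e2, e3, e4, e5, e6]
    ring
  obtain ⟨w', hw'1, hw'2⟩ := S.closed w hlim.cauchySeq henergy
  have hw'3 : (w' : Lp ℝ 2 P) = hF0.toLp := tendsto_nhds_unique hw'1 hlim
  refine ⟨w', by rw [hw'3]; exact hF0.coeFn_toLp, fun v => S.Γ_eq_of_tendsto hw'2 v ?_⟩
  filter_upwards [ae_all_iff.2 fun n => hwΓ n v] with ω h
  simp only [h]
  exact (hfdt _).mul_const _

end ErrorStructure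

/-! ### Product rule, and chain rule for the generator. -/

lemma L2_inner_eq_integral {Ω : Type*} [MeasurableSpace Ω] {P : Measure Ω} (f g : Lp ℝ 2 P) :
    inner ℝ f g = ∫ ω, f ω * g ω ∂P := by
  rw [L2.inner_def]
  refine integral_congr_ae (Eventually.of_forall fun ω => ?_)
  simp [mul_comm]

namespace ErrorStructure

variable {Ω : Type*} [MeasurableSpace Ω] {P : Measure Ω} [IsProbabilityMeasure P]

/-- Squaring is not Lipschitz, but boundedness of `u` supplies both integrability conditions of
`exists_comp`. -/
lemma exists_sq (S : ErrorStructure P) (u : S.D) {M : ℝ}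
    (hu : ∀ᵐ ω ∂P, |(u : Lp ℝ 2 P) ω| ≤ M) :
    ∃ w : S.D, (∀ᵐ ω ∂P, (w : Lp ℝ 2 P) ω = (u : Lp ℝ 2 P) ω ^ 2) ∧
      ∀ v : S.D, ∀ᵐ ω ∂P, S.Γ w v ω = 2 * (u : Lp ℝ 2 P) ω * S.Γ u v ω := by
  have hum : AEStronglyMeasurable (u : Lp ℝ 2 P) P := (Lp.memLp _).1
  have hd : ∀ x : ℝ, deriv (fun x : ℝ => x ^ 2) x = 2 * x := fun x => by simp
  obtain ⟨w, hw, hw'⟩ := S.exists_comp (F := fun x => x ^ 2) (contDiff_id.pow 2) u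
    (MemLp.of_bound (hum.pow 2) (M ^ 2) (by
      filter_upwards [hu] with ω h
      rw [Real.norm_of_nonneg (sq_nonneg _), ← sq_abs]
      exact pow_le_pow_left₀ (abs_nonneg _) h 2))
    (by
      simp only [hd]
      refine (S.integrable_Γ u u).bdd_mul (c := (2 * M) ^ 2) ((hum.const_mul 2).pow 2) ?_
      filter_upwards [hu] with ω h
      rw [Real.norm_of_nonneg (sq_nonneg _), ← sq_abs]
      refine pow_le_pow_left₀ (abs_nonneg _) ?_ 2
      rw [abs_mul, abs_two]
      linarith)
  exact ⟨w, hw, fun v => by simpa only [hd] using hw' v⟩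

/-- The product rule for bounded functions. -/
lemma exists_mul (S : ErrorStructure P) (u v : S.D) {M N : ℝ}
    (hu : ∀ᵐ ω ∂P, |(u : Lp ℝ 2 P) ω| ≤ M) (hv : ∀ᵐ ω ∂P, |(v : Lp ℝ 2 P) ω| ≤ N) :
    ∃ w : S.D, (∀ᵐ ω ∂P, (w : Lp ℝ 2 P) ω = (u : Lp ℝ 2 P) ω * (v : Lp ℝ 2 P) ω) ∧
      ∀ z : S.D, ∀ᵐ ω ∂P, S.Γ w z ω =
        (u : Lp ℝ 2 P) ω * S.Γ v z ω + (v : Lp ℝ 2 P) ω * S.Γ u z ω := by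
  have eadd : ∀ᵐ ω ∂P, ((u + v : S.D) : Lp ℝ 2 P) ω = (u : Lp ℝ 2 P) ω + (v : Lp ℝ 2 P) ω :=
    Lp.coeFn_add _ _
  have esub : ∀ᵐ ω ∂P, ((u - v : S.D) : Lp ℝ 2 P) ω = (u : Lp ℝ 2 P) ω - (v : Lp ℝ 2 P) ω :=
    Lp.coeFn_sub _ _
  -- Polarization: `u v = ¼ ((u + v)² - (u - v)²)`.
  obtain ⟨p, hp, hp'⟩ := S.exists_sq (u + v) (M := M + N) (by
    filter_upwards [hu, hv, eadd] with ω h1 h2 h3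
    rw [h3]
    exact (abs_add_le _ _).trans (add_le_add h1 h2))
  obtain ⟨q, hq, hq'⟩ := S.exists_sq (u - v) (M := M + N) (by
    filter_upwards [hu, hv, esub] with ω h1 h2 h3
    rw [h3]
    exact (abs_sub _ _).trans (add_le_add h1 h2))
  have esub' : ∀ᵐ ω ∂P, ((p - q : S.D) : Lp ℝ 2 P) ω = (p : Lp ℝ 2 P) ω - (q : Lp ℝ 2 P) ω :=
    Lp.coeFn_sub _ _
  have esm : ∀ᵐ ω ∂P, (((1 / 4 : ℝ) • (p - q) : S.D) : Lp ℝ 2 P) ω =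
      1 / 4 * ((p - q : S.D) : Lp ℝ 2 P) ω := Lp.coeFn_smul _ _
  refine ⟨(1 / 4 : ℝ) • (p - q), ?_, fun z => ?_⟩
  · filter_upwards [hp, hq, eadd, esub, esub', esm] with ω h1 h2 h3 h4 h5 h6
    rw [h6, h5, h1, h2, h3, h4]
    ring
  · filter_upwards [hp' z, hq' z, eadd, esub, S.Γ_smul_left (1 / 4) (p - q) z,
      S.Γ_sub_left p q z, S.Γ_add_left u v z, S.Γ_sub_left u v z]
      with ω h1 h2 h3 h4 h5 h6 h7 h8
    rw [h5, h6, h1, h2, h3, h4, h7, h8]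
    ring

/-- To identify the generator it is enough to test against bounded functions. -/
lemma mem_generatorGraph_of_bounded (S : ErrorStructure P) (u : S.D) (f : Lp ℝ 2 P)
    (h : ∀ v : S.D, (∃ M, ∀ᵐ ω ∂P, |(v : Lp ℝ 2 P) ω| ≤ M) →
      S.energy u v = -∫ ω, f ω * (v : Lp ℝ 2 P) ω ∂P) :
    ((u : Lp ℝ 2 P), f) ∈ S.generatorGraph := by
  refine ⟨u.2, fun v => ?_⟩
  have hpos : ∀ n : ℕ, (0 : ℝ) < n + 1 := fun n => by positivity
  have hfm : AEStronglyMeasurable f P := (Lp.memLp _).1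
  -- The bounded truncations `(n + 1) arctan (v / (n + 1))` have derivative at most `1` and are
  -- dominated by `|v|`, so both sides of the identity pass to the limit.
  choose w hw hwΓ using fun n : ℕ => S.exists_lipschitz_comp
    (contDiff_mul_arctan_div ((n : ℝ) + 1)) ⟨1, lipschitzWith_mul_arctan_div (hpos n).ne'⟩ v
  have hb : ∀ n, S.energy u (w n) = -∫ ω, f ω * (w n : Lp ℝ 2 P) ω ∂P := fun n =>
    h (w n) ⟨2 * (n + 1), by
      filter_upwards [hw n] with ω hω
      rw [hω]
      exact abs_mul_arctan_div_le_const (hpos n) _⟩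
  have hL : Tendsto (fun n => ∫ ω, S.Γ u (w n) ω ∂P) atTop (𝓝 (∫ ω, S.Γ u v ω ∂P)) := by
    refine tendsto_integral_of_dominated_convergence (fun ω => |S.Γ u v ω|)
      (fun n => (S.integrable_Γ _ _).1) (S.integrable_Γ u v).abs (fun n => ?_) ?_
    · rw [S.symm u (w n), S.symm u v]
      filter_upwards [hwΓ n u] with ω hω
      rw [hω, (hasDerivAt_mul_arctan_div (hpos n).ne' _).deriv, Real.norm_eq_abs, abs_mul]
      exact mul_le_of_le_one_left (abs_nonneg _) (abs_one_div_one_add_sq_le _)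
    · filter_upwards [ae_all_iff.2 fun n => hwΓ n u] with ω hω
      have e : ∀ n, S.Γ u (w n) ω =
          1 / (1 + ((v : Lp ℝ 2 P) ω / ((n : ℝ) + 1)) ^ 2) * S.Γ u v ω := fun n => by
        rw [S.symm u (w n), hω n, (hasDerivAt_mul_arctan_div (hpos n).ne' _).deriv, S.symm u v]
      simp only [e]
      have h2 : Tendsto (fun n : ℕ => (v : Lp ℝ 2 P) ω / ((n : ℝ) + 1)) atTop (𝓝 0) := by
        have := (tendsto_one_div_add_atTop_nhds_zero_nat (𝕜 := ℝ)).const_mul ((v : Lp ℝ 2 P) ω)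
        simpa [div_eq_mul_inv] using this
      have := (((h2.pow 2).const_add 1).inv₀ (by norm_num)).mul_const (S.Γ u v ω)
      simpa using this
  have hR : Tendsto (fun n => ∫ ω, f ω * (w n : Lp ℝ 2 P) ω ∂P) atTop
      (𝓝 (∫ ω, f ω * (v : Lp ℝ 2 P) ω ∂P)) := by
    refine tendsto_integral_of_dominated_convergence (fun ω => |f ω * (v : Lp ℝ 2 P) ω|)
      (fun n => hfm.mul (Lp.memLp _).1)
      ((Lp.memLp f).integrable_mul (Lp.memLp (v : Lp ℝ 2 P))).abs (fun n => ?_) ?_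
    · filter_upwards [hw n] with ω hω
      rw [hω, Real.norm_eq_abs, abs_mul, abs_mul (f ω)]
      exact mul_le_mul_of_nonneg_left (abs_mul_arctan_div_le (hpos n).ne' _) (abs_nonneg _)
    · filter_upwards [ae_all_iff.2 hw] with ω hω
      simp only [hω]
      exact (tendsto_mul_arctan_div _).const_mul _
  rw [L2_inner_eq_integral]
  refine tendsto_nhds_unique (hL.const_mul (1 / 2 : ℝ)) (hR.neg.congr fun n => ?_)
  exact (hb n).symm

/-- The chain rule for the generator. -/
theorem comp_mem_generatorGraph (S : ErrorStructure P) {F : ℝ → ℝ} (hF : ContDiff ℝ 2 F)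
    (X : S.D) (A f : Lp ℝ 2 P) (hX : ((X : Lp ℝ 2 P), A) ∈ S.generatorGraph) (w : S.D)
    (hwΓ : ∀ v : S.D, ∀ᵐ ω ∂P, S.Γ w v ω = deriv F ((X : Lp ℝ 2 P) ω) * S.Γ X v ω)
    (hf : ∀ᵐ ω ∂P, f ω = deriv F ((X : Lp ℝ 2 P) ω) * A ω
      + 1 / 2 * deriv (deriv F) ((X : Lp ℝ 2 P) ω) * S.Γ X X ω) :
    ((w : Lp ℝ 2 P), f) ∈ S.generatorGraph := by
  obtain ⟨χ, C, hC, hχ, hχc, hχ1, hχd, hχt⟩ := exists_seq_cutoff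
  obtain ⟨hXD, hXA⟩ := hX
  refine S.mem_generatorGraph_of_bounded w f fun v ⟨M, hM⟩ => ?_
  have hXm : AEStronglyMeasurable (X : Lp ℝ 2 P) P := (Lp.memLp _).1
  have hvm : AEStronglyMeasurable (v : Lp ℝ 2 P) P := (Lp.memLp _).1
  have hfm : AEStronglyMeasurable f P := (Lp.memLp _).1
  have hF' : ContDiff ℝ 1 (deriv F) := by
    have := (contDiff_succ_iff_deriv (n := 1)).1 hF
    exact this.2.2
  have hp : ∀ n, ContDiff ℝ 1 (fun x => deriv F x * χ n x) := fun n => hF'.mul (hχ n)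
  have hpc : ∀ n, HasCompactSupport (fun x => deriv F x * χ n x) := fun n => (hχc n).mul_left
  have hpd : ∀ n x, deriv (fun x => deriv F x * χ n x) x =
      deriv (deriv F) x * χ n x + deriv F x * deriv (χ n) x := fun n x =>
    ((hF'.differentiable one_ne_zero x).hasDerivAt.mul
      ((hχ n).differentiable one_ne_zero x).hasDerivAt).deriv
  choose p hpw hpΓ using fun n => S.exists_lipschitz_comp (hp n)
    ⟨_, ((hp n).lipschitzWith_of_hasCompactSupport (hpc n) one_ne_zero).choose_spec⟩ X
  have hpb : ∀ n, ∃ B, ∀ᵐ ω ∂P, |(p n : Lp ℝ 2 P) ω| ≤ B := fun n => by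
    obtain ⟨B, hB⟩ : ∃ B, ∀ x, ‖deriv F x * χ n x‖ ≤ B :=
      (hpc n).exists_bound_of_continuous (hp n).continuous
    refine ⟨B, ?_⟩
    filter_upwards [hpw n] with ω hω
    rw [hω]
    exact hB _
  choose B hB using hpb
  choose z hz hzΓ using fun n => S.exists_mul (p n) v (hB n) hM
  -- Test `X` against `z n = F'(X) χ n(X) v`. The terms in `A z n` cancel, leaving only `f`; hence
  -- the limit never needs `F'(X) A[X]` and `F''(X) Γ[X]` to be separately in `L²`. The term with `χ
  -- n'` is the error of the cutoff and vanishes like `C / (n + 1)`.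
  have hident : ∀ n, ∫ ω, χ n ((X : Lp ℝ 2 P) ω) * S.Γ w v ω ∂P
      + ∫ ω, deriv (χ n) ((X : Lp ℝ 2 P) ω) * (v : Lp ℝ 2 P) ω * S.Γ w X ω ∂P
      = -2 * ∫ ω, χ n ((X : Lp ℝ 2 P) ω) * (f ω * (v : Lp ℝ 2 P) ω) ∂P := by
    intro n
    have hE : (1 / 2 : ℝ) * ∫ ω, S.Γ X (z n) ω ∂P = -∫ ω, A ω * (z n : Lp ℝ 2 P) ω ∂P := by
      rw [← L2_inner_eq_integral]
      exact hXA (z n)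
    have hχm : AEStronglyMeasurable (fun ω => χ n ((X : Lp ℝ 2 P) ω)) P :=
      (hχ n).continuous.comp_aestronglyMeasurable hXm
    have hχm' : AEStronglyMeasurable (fun ω => deriv (χ n) ((X : Lp ℝ 2 P) ω)) P :=
      ((hχ n).continuous_deriv le_rfl).comp_aestronglyMeasurable hXm
    have i1 : Integrable (fun ω => χ n ((X : Lp ℝ 2 P) ω) * S.Γ w v ω) P :=
      (S.integrable_Γ w v).bdd_mul hχm (Eventually.of_forall fun ω => hχ1 n _)
    have i2 : Integrable (fun ω => deriv (χ n) ((X : Lp ℝ 2 P) ω) * (v : Lp ℝ 2 P) ω *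
        S.Γ w X ω) P := by
      refine (S.integrable_Γ w X).bdd_mul (c := C / (n + 1) * M) (hχm'.mul hvm) ?_
      filter_upwards [hM] with ω hω
      rw [Real.norm_eq_abs, abs_mul]
      exact mul_le_mul (hχd _ _) hω (abs_nonneg _) (by positivity)
    have i3 : Integrable (fun ω => χ n ((X : Lp ℝ 2 P) ω) * (f ω * (v : Lp ℝ 2 P) ω)) P :=
      ((Lp.memLp f).integrable_mul (Lp.memLp (v : Lp ℝ 2 P))).bdd_mul hχm
        (Eventually.of_forall fun ω => hχ1 n _)
    have i4 : Integrable (fun ω => A ω * (z n : Lp ℝ 2 P) ω) P :=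
      (Lp.memLp A).integrable_mul (Lp.memLp (z n : Lp ℝ 2 P))
    have hae : ∀ᵐ ω ∂P, S.Γ X (z n) ω = (χ n ((X : Lp ℝ 2 P) ω) * S.Γ w v ω
        + deriv (χ n) ((X : Lp ℝ 2 P) ω) * (v : Lp ℝ 2 P) ω * S.Γ w X ω)
        + 2 * (χ n ((X : Lp ℝ 2 P) ω) * (f ω * (v : Lp ℝ 2 P) ω))
        - 2 * (A ω * (z n : Lp ℝ 2 P) ω) := by
      have e1 := hzΓ n X
      rw [S.symm (z n) X, S.symm v X] at e1
      filter_upwards [e1, hz n, hpw n, hpΓ n X, hwΓ v, hwΓ X, hf] with ω e1 e2 e3 e4 e5 e6 e7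
      rw [e1, e2, e3, e4, e5, e6, e7, hpd]
      ring
    have i5 := integral_sub ((i1.add i2).add (i3.const_mul 2)) (i4.const_mul 2)
    have i6 := integral_add (i1.add i2) (i3.const_mul 2)
    have i7 := integral_add i1 i2
    simp only [Pi.add_apply, integral_const_mul] at i5 i6 i7
    rw [integral_congr_ae hae, i5, i6, i7] at hE
    linarith
  have h1 : Tendsto (fun n => ∫ ω, χ n ((X : Lp ℝ 2 P) ω) * S.Γ w v ω ∂P) atTop
      (𝓝 (∫ ω, S.Γ w v ω ∂P)) := by
    refine tendsto_integral_of_dominated_convergence (fun ω => |S.Γ w v ω|)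
      (fun n => ((hχ n).continuous.comp_aestronglyMeasurable hXm).mul (S.integrable_Γ _ _).1)
      (S.integrable_Γ w v).abs (fun n => Eventually.of_forall fun ω => ?_)
      (Eventually.of_forall fun ω => ?_)
    · rw [Real.norm_eq_abs, abs_mul]
      exact mul_le_of_le_one_left (abs_nonneg _) (hχ1 _ _)
    · simpa using (hχt ((X : Lp ℝ 2 P) ω)).mul_const (S.Γ w v ω)
  have h2 : Tendsto (fun n => ∫ ω, deriv (χ n) ((X : Lp ℝ 2 P) ω) * (v : Lp ℝ 2 P) ω *
      S.Γ w X ω ∂P) atTop (𝓝 0) := by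
    have hint : Integrable (fun ω => (v : Lp ℝ 2 P) ω * S.Γ w X ω) P :=
      (S.integrable_Γ w X).bdd_mul hvm hM
    refine squeeze_zero_norm (a := fun n : ℕ => C / ((n : ℝ) + 1) *
      ∫ ω, |(v : Lp ℝ 2 P) ω * S.Γ w X ω| ∂P) (fun n => ?_) ?_
    · rw [← integral_const_mul]
      refine norm_integral_le_of_norm_le (hint.abs.const_mul _) (Eventually.of_forall fun ω => ?_)
      rw [Real.norm_eq_abs, mul_assoc, abs_mul]
      exact mul_le_mul_of_nonneg_right (hχd _ _) (abs_nonneg _)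
    · have := ((tendsto_one_div_add_atTop_nhds_zero_nat (𝕜 := ℝ)).const_mul C).mul_const
        (∫ ω, |(v : Lp ℝ 2 P) ω * S.Γ w X ω| ∂P)
      simpa [div_eq_mul_inv] using this
  have h3 : Tendsto (fun n => ∫ ω, χ n ((X : Lp ℝ 2 P) ω) * (f ω * (v : Lp ℝ 2 P) ω) ∂P) atTop
      (𝓝 (∫ ω, f ω * (v : Lp ℝ 2 P) ω ∂P)) := by
    refine tendsto_integral_of_dominated_convergence (fun ω => |f ω * (v : Lp ℝ 2 P) ω|)
      (fun n => ((hχ n).continuous.comp_aestronglyMeasurable hXm).mul (hfm.mul hvm))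
      ((Lp.memLp f).integrable_mul (Lp.memLp (v : Lp ℝ 2 P))).abs
      (fun n => Eventually.of_forall fun ω => ?_) (Eventually.of_forall fun ω => ?_)
    · rw [Real.norm_eq_abs, abs_mul]
      exact mul_le_of_le_one_left (abs_nonneg _) (hχ1 _ _)
    · simpa using (hχt ((X : Lp ℝ 2 P) ω)).mul_const (f ω * (v : Lp ℝ 2 P) ω)
  have h4 := tendsto_nhds_unique ((h1.add h2).congr hident) (h3.const_mul (-2))
  unfold energy
  linarith

end ErrorStructure

/-! ### Gaussian laws concentrating at a point. -/

lemma isLittleO_inv_mul_exp_neg_div {c : ℝ} (hc : 0 < c) (K : ℝ) :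
    (fun ε : ℝ => K * (ε⁻¹ * Real.exp (-c * ε⁻¹))) =o[𝓝[>] 0] fun ε => ε := by
  have h := ((tendsto_rpow_mul_exp_neg_mul_atTop_nhds_zero 2 c hc).comp
    tendsto_inv_nhdsGT_zero).const_mul K
  rw [mul_zero] at h
  refine (isLittleO_iff_tendsto' ?_).2 (h.congr' ?_)
  · filter_upwards [self_mem_nhdsWithin] with ε hε h0
    exact absurd h0 (ne_of_gt hε)
  · filter_upwards [self_mem_nhdsWithin] with ε hε
    have : ε ≠ 0 := ne_of_gt hε
    simp only [Function.comp_apply, Real.rpow_ofNat]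
    field_simp

/-- Outside of a neighbourhood of `σ`, the Gaussian laws which concentrate at `σ` are dominated by
any fixed Gaussian law centred at `σ`, with a negligible constant. -/
lemma gaussianReal_restrict_le (σ a : ℝ) {γ : ℝ} (hγ : 0 ≤ γ) {s : ℝ≥0} (hs : s ≠ 0)
    {δ : ℝ} (hδ : 0 < δ) :
    ∃ r : ℝ → ℝ, (r =o[𝓝[>] 0] fun ε => ε) ∧ ∀ᶠ ε in 𝓝[>] (0 : ℝ), 0 ≤ r ε ∧
      (gaussianReal (σ + ε * a) (ε * γ).toNNReal).restrict {y | δ < |y - σ|} ≤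
        ENNReal.ofReal (r ε) • gaussianReal σ s := by
  have hT : MeasurableSet {y : ℝ | δ < |y - σ|} := measurableSet_lt (by fun_prop) (by fun_prop)
  have hsmall : ∀ᶠ ε in 𝓝[>] (0 : ℝ), ε * |a| < δ / 2 := by
    have : Tendsto (fun ε : ℝ => ε * |a|) (𝓝[>] 0) (𝓝 (0 * |a|)) :=
      ((continuous_id.mul continuous_const).tendsto 0).mono_left nhdsWithin_le_nhds
    rw [zero_mul] at this
    exact this.eventually_lt_const (by positivity)
  -- For `γ = 0` the law is the Dirac mass at `σ + ε a`, which lies within `δ` of `σ` for small `ε`.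
  rcases hγ.eq_or_lt with rfl | hγ
  · refine ⟨fun _ => 0, isLittleO_zero _ _, ?_⟩
    filter_upwards [hsmall, self_mem_nhdsWithin] with ε h1 h2
    have h2' : 0 < ε := h2
    refine ⟨le_rfl, ?_⟩
    rw [mul_zero, Real.toNNReal_zero, gaussianReal_zero_var, Measure.restrict_eq_zero.2]
    · exact Measure.zero_le _
    · rw [Measure.dirac_apply' _ hT, Set.indicator_of_notMem]
      simp only [Set.mem_ofPred_eq, add_sub_cancel_left, abs_mul, abs_of_pos h2', not_lt]
      linarith
  have hs' : (0 : ℝ) < s := NNReal.coe_pos.2 (pos_iff_ne_zero.2 hs)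
  refine ⟨fun ε => √(2 * Real.pi * s) * (√(2 * Real.pi * γ))⁻¹ *
    (ε⁻¹ * Real.exp (-(δ ^ 2 / (16 * γ)) * ε⁻¹)),
    isLittleO_inv_mul_exp_neg_div (by positivity) _, ?_⟩
  have hεs : ∀ᶠ ε in 𝓝[>] (0 : ℝ), ε * γ < s / 8 := by
    have : Tendsto (fun ε : ℝ => ε * γ) (𝓝[>] 0) (𝓝 (0 * γ)) :=
      ((continuous_id.mul continuous_const).tendsto 0).mono_left nhdsWithin_le_nhds
    rw [zero_mul] at this
    exact this.eventually_lt_const (by positivity)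
  have hε1 : ∀ᶠ ε in 𝓝[>] (0 : ℝ), ε < 1 :=
    (eventually_lt_nhds one_pos).filter_mono nhdsWithin_le_nhds
  filter_upwards [hsmall, hεs, hε1, self_mem_nhdsWithin] with ε h1 h2 h3 h4
  have hε : 0 < ε := h4
  have hr : 0 ≤ √(2 * Real.pi * s) * (√(2 * Real.pi * γ))⁻¹ *
    (ε⁻¹ * Real.exp (-(δ ^ 2 / (16 * γ)) * ε⁻¹)) := by positivity
  refine ⟨hr, ?_⟩
  have hv : (ε * γ).toNNReal ≠ 0 := (Real.toNNReal_pos.2 (by positivity)).ne'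
  have hvc : ((ε * γ).toNNReal : ℝ) = ε * γ := Real.coe_toNNReal _ (by positivity)
  have hpt : ∀ y, δ < |y - σ| → gaussianPDF (σ + ε * a) (ε * γ).toNNReal y ≤
      ENNReal.ofReal (√(2 * Real.pi * s) * (√(2 * Real.pi * γ))⁻¹ *
        (ε⁻¹ * Real.exp (-(δ ^ 2 / (16 * γ)) * ε⁻¹))) * gaussianPDF σ s y := by
    intro y hy
    rw [gaussianPDF, gaussianPDF, ← ENNReal.ofReal_mul hr]
    refine ENNReal.ofReal_le_ofReal ?_
    rw [gaussianPDFReal, gaussianPDFReal, hvc]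
    have hsq : (√(2 * Real.pi * (ε * γ)))⁻¹ ≤ (√(2 * Real.pi * γ))⁻¹ * ε⁻¹ := by
      rw [← mul_inv]
      refine inv_anti₀ (by positivity) ?_
      have e : √(2 * Real.pi * (ε * γ)) = √(2 * Real.pi * γ) * √ε := by
        rw [← Real.sqrt_mul (by positivity)]
        congr 1
        ring
      rw [e]
      refine mul_le_mul_of_nonneg_left (Real.le_sqrt_of_sq_le ?_) (Real.sqrt_nonneg _)
      nlinarith
    -- Since `|y - σ - ε a| ≥ |y - σ| / 2`, the exponent is at most `-(y - σ)² / (8 ε γ)`. One half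
    -- of this is bounded using `|y - σ| > δ`, which produces the constant `16`; the other half
    -- using `ε γ < s / 8`, which leaves the exponent of the fixed law.
    have hexp : -(y - (σ + ε * a)) ^ 2 / (2 * (ε * γ)) ≤
        -(δ ^ 2 / (16 * γ)) * ε⁻¹ + -(y - σ) ^ 2 / (2 * s) := by
      have hq : |y - σ| / 2 ≤ |y - (σ + ε * a)| := by
        have e1 := abs_sub_abs_le_abs_sub (y - σ) (ε * a)
        rw [abs_mul, abs_of_pos hε, sub_sub] at e1
        linarith
      have hq2 : (y - σ) ^ 2 / 4 ≤ (y - (σ + ε * a)) ^ 2 := by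
        have := pow_le_pow_left₀ (by positivity) hq 2
        rw [div_pow, sq_abs, sq_abs] at this
        linarith
      have hd2 : δ ^ 2 ≤ (y - σ) ^ 2 := by
        have := pow_le_pow_left₀ hδ.le hy.le 2
        rwa [sq_abs] at this
      have k1 : (y - σ) ^ 2 / (8 * (ε * γ)) ≤ (y - (σ + ε * a)) ^ 2 / (2 * (ε * γ)) := by
        rw [div_le_div_iff₀ (by positivity) (by positivity)]
        have : 0 < ε * γ := by positivity
        nlinarith
      have k2 : δ ^ 2 / (16 * γ) * ε⁻¹ ≤ (y - σ) ^ 2 / (16 * (ε * γ)) := by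
        rw [show δ ^ 2 / (16 * γ) * ε⁻¹ = δ ^ 2 / (16 * (ε * γ)) by field_simp]
        gcongr
      have k3 : (y - σ) ^ 2 / (2 * s) ≤ (y - σ) ^ 2 / (16 * (ε * γ)) := by
        refine div_le_div_of_nonneg_left (sq_nonneg _) (by positivity) (by linarith)
      have k4 : (y - σ) ^ 2 / (8 * (ε * γ)) =
          (y - σ) ^ 2 / (16 * (ε * γ)) + (y - σ) ^ 2 / (16 * (ε * γ)) := by
        field_simp
        ring
      rw [neg_div, neg_div]
      linarith
    calc (√(2 * Real.pi * (ε * γ)))⁻¹ * Real.exp (-(y - (σ + ε * a)) ^ 2 / (2 * (ε * γ)))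
        ≤ (√(2 * Real.pi * γ))⁻¹ * ε⁻¹ * (Real.exp (-(δ ^ 2 / (16 * γ)) * ε⁻¹) *
          Real.exp (-(y - σ) ^ 2 / (2 * s))) := by
          rw [← Real.exp_add]
          exact mul_le_mul hsq (Real.exp_le_exp.2 hexp) (Real.exp_pos _).le (by positivity)
      _ = _ := by
          have : √(2 * Real.pi * s) ≠ 0 := by positivity
          field_simp
  rw [gaussianReal_of_var_ne_zero _ hv, gaussianReal_of_var_ne_zero _ hs]
  refine Measure.le_intro fun B hB _ => ?_
  rw [Measure.restrict_apply hB, withDensity_apply _ (hB.inter hT), Measure.smul_apply,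
    withDensity_apply _ hB, smul_eq_mul, ← lintegral_const_mul _ (measurable_gaussianPDF _ _)]
  exact (setLIntegral_mono' (hB.inter hT) fun y hy => hpt y hy.2).trans
    (lintegral_mono_set Set.inter_subset_left)

lemma integrable_sq_sub_gaussianReal (m σ : ℝ) (v : ℝ≥0) :
    Integrable (fun y => (y - σ) ^ 2) (gaussianReal m v) :=
  ((memLp_id_gaussianReal 2).sub (memLp_const σ)).integrable_sq

lemma integral_sub_gaussianReal (m σ : ℝ) (v : ℝ≥0) :
    ∫ y, (y - σ) ∂gaussianReal m v = m - σ := by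
  have h : Integrable (fun y : ℝ => y) (gaussianReal m v) :=
    (memLp_id_gaussianReal 1).integrable (by simp)
  rw [integral_sub h (integrable_const _), integral_id_gaussianReal]
  simp

lemma integral_sq_sub_gaussianReal (m σ : ℝ) (v : ℝ≥0) :
    ∫ y, (y - σ) ^ 2 ∂gaussianReal m v = v + (m - σ) ^ 2 := by
  have h := variance_eq_sub (μ := gaussianReal m v) (X := fun y => y - σ)
    ((memLp_id_gaussianReal 2).sub (memLp_const σ))
  rw [variance_sub_const (X := fun y => y) (by fun_prop), integral_sub_gaussianReal] at h
  have h2 : variance (fun y : ℝ => y) (gaussianReal m v) = v := variance_id_gaussianReal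
  rw [h2] at h
  simp only [Pi.pow_apply] at h
  linarith

/-- The Gaussian laws with mean `σ + ε a` and variance `ε γ` integrate to `o(ε)` a function which
is `o((y - σ)²)` at `σ` and is integrable for some Gaussian law centred at `σ`. -/
theorem gaussianReal_integral_isLittleO (σ a : ℝ) {γ : ℝ} (hγ : 0 ≤ γ) {s : ℝ≥0} (hs : s ≠ 0)
    {H : ℝ → ℝ} (hH : Measurable H) (hHs : Integrable H (gaussianReal σ s))
    (hHσ : H =o[𝓝 σ] fun y => (y - σ) ^ 2) :
    (∀ᶠ ε in 𝓝[>] (0 : ℝ), Integrable H (gaussianReal (σ + ε * a) (ε * γ).toNNReal)) ∧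
      (fun ε : ℝ => ∫ y, H y ∂gaussianReal (σ + ε * a) (ε * γ).toNNReal) =o[𝓝[>] 0]
        fun ε => ε := by
  have key : ∀ η > 0, ∀ᶠ ε in 𝓝[>] (0 : ℝ),
      Integrable H (gaussianReal (σ + ε * a) (ε * γ).toNNReal) ∧
      ‖∫ y, H y ∂gaussianReal (σ + ε * a) (ε * γ).toNNReal‖ ≤ η * ε := by
    intro η hη
    -- The region near `σ` contributes `η' (ε γ + ε² a²)`, at most `ε η / 2` when `ε < 1`; the far
    -- region gets the other half. The `+ 1` keeps the denominator positive.
    set η' := η / (2 * (γ + a ^ 2 + 1)) with hη'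
    have hη'0 : 0 < η' := by positivity
    obtain ⟨δ, hδ, hb⟩ := Metric.nhds_basis_closedBall.eventually_iff.1
      ((isLittleO_iff.1 hHσ) hη'0)
    obtain ⟨r, hr, hrT⟩ := gaussianReal_restrict_le σ a hγ hs hδ
    have hT : MeasurableSet {y : ℝ | δ < |y - σ|} := measurableSet_lt (by fun_prop) (by fun_prop)
    set K := ∫ y, ‖H y‖ ∂gaussianReal σ s with hK
    have hK0 : 0 ≤ K := integral_nonneg fun _ => norm_nonneg _
    have hrK : ∀ᶠ ε in 𝓝[>] (0 : ℝ), ‖r ε‖ ≤ η / (2 * (K + 1)) * ‖ε‖ :=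
      isLittleO_iff.1 hr (by positivity)
    have hε1 : ∀ᶠ ε in 𝓝[>] (0 : ℝ), ε < 1 :=
      (eventually_lt_nhds one_pos).filter_mono nhdsWithin_le_nhds
    filter_upwards [hrT, hrK, hε1, self_mem_nhdsWithin] with ε ⟨hr0, hle⟩ h2 h3 h4
    have hε : 0 < ε := h4
    set μ := gaussianReal (σ + ε * a) (ε * γ).toNNReal with hμ
    have hM : ∫ y, (y - σ) ^ 2 ∂μ = ε * γ + (ε * a) ^ 2 := by
      rw [hμ, integral_sq_sub_gaussianReal, Real.coe_toNNReal _ (by positivity)]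
      ring
    have hlin : ∫⁻ y, ‖H y‖ₑ ∂μ ≤
        ENNReal.ofReal (r ε * K + η' * (ε * γ + (ε * a) ^ 2)) := by
      rw [← lintegral_add_compl _ hT, ENNReal.ofReal_add (by positivity) (by positivity)]
      refine add_le_add ?_ ?_
      · refine (lintegral_mono' hle le_rfl).trans ?_
        rw [lintegral_smul_measure, ENNReal.ofReal_mul hr0, hK,
          ofReal_integral_norm_eq_lintegral_enorm hHs, smul_eq_mul]
      · calc ∫⁻ y in {y | δ < |y - σ|}ᶜ, ‖H y‖ₑ ∂μ
            ≤ ∫⁻ y in {y | δ < |y - σ|}ᶜ, ENNReal.ofReal (η' * (y - σ) ^ 2) ∂μ := by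
              refine setLIntegral_mono' hT.compl fun y hy => ?_
              rw [← ofReal_norm]
              refine ENNReal.ofReal_le_ofReal ?_
              have := hb (x := y) (by simpa [Real.dist_eq] using hy)
              rwa [Real.norm_of_nonneg (sq_nonneg _)] at this
          _ ≤ ∫⁻ y, ENNReal.ofReal (η' * (y - σ) ^ 2) ∂μ := setLIntegral_le_lintegral _ _
          _ = ENNReal.ofReal (η' * (ε * γ + (ε * a) ^ 2)) := by
              rw [← hM, ← integral_const_mul, ofReal_integral_eq_lintegral_ofReal
                ((integrable_sq_sub_gaussianReal _ _ _).const_mul _)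
                (Eventually.of_forall fun y => by positivity)]
    have hint : Integrable H μ := ⟨hH.aestronglyMeasurable, hlin.trans_lt ENNReal.ofReal_lt_top⟩
    refine ⟨hint, ?_⟩
    have hnorm : ‖∫ y, H y ∂μ‖ ≤ r ε * K + η' * (ε * γ + (ε * a) ^ 2) := by
      refine (norm_integral_le_integral_norm _).trans ?_
      rw [← ENNReal.ofReal_le_ofReal_iff (by positivity),
        ofReal_integral_norm_eq_lintegral_enorm hint]
      exact hlin
    refine hnorm.trans ?_
    rw [Real.norm_of_nonneg hr0, Real.norm_of_nonneg hε.le] at h2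
    have k1 : r ε * K ≤ η / 2 * ε := by
      calc r ε * K ≤ (η / (2 * (K + 1)) * ε) * (K + 1) := by gcongr; linarith
        _ = η / 2 * ε := by field_simp
    have k2 : η' * (ε * γ + (ε * a) ^ 2) ≤ η / 2 * ε := by
      calc η' * (ε * γ + (ε * a) ^ 2) ≤ η' * ((γ + a ^ 2 + 1) * ε) := by
            gcongr
            nlinarith [sq_nonneg a, mul_nonneg (mul_nonneg hε.le (sub_nonneg.2 h3.le)) (sq_nonneg a)]
        _ = η / 2 * ε := by rw [hη']; field_simp
    linarith
  refine ⟨(key 1 one_pos).mono fun ε h => h.1, isLittleO_iff.2 fun c hc => ?_⟩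
  filter_upwards [key c hc, self_mem_nhdsWithin] with ε h h4
  rw [Real.norm_of_nonneg (le_of_lt h4)]
  exact h.2

/-! ### Taylor expansions integrated against the Gaussian laws. -/

/-- Second order Taylor expansion. -/
lemma isLittleO_taylor_two {F : ℝ → ℝ} (hF : ContDiff ℝ 2 F) (σ : ℝ) :
    (fun y => F y - F σ - deriv F σ * (y - σ) - 1 / 2 * deriv (deriv F) σ * (y - σ) ^ 2)
      =o[𝓝 σ] fun y => (y - σ) ^ 2 := by
  have h := taylor_isLittleO_univ (x₀ := σ) (n := 2) hF
  refine h.congr_left fun y => ?_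
  simp only [taylorWithinEval_succ, taylor_within_zero_eval, iteratedDerivWithin_univ,
    iteratedDeriv_succ, iteratedDeriv_zero]
  simp [Nat.factorial]
  ring

lemma isLittleO_taylor_one {F : ℝ → ℝ} (hF : ContDiff ℝ 2 F) (σ : ℝ) :
    (fun y => F y - F σ - deriv F σ * (y - σ)) =o[𝓝 σ] fun y => y - σ := by
  have h := (hF.differentiable two_ne_zero σ).hasDerivAt.isLittleO
  simpa [mul_comm] using h

lemma isLittleO_const_mul_sq (c : ℝ) : (fun ε : ℝ => c * ε ^ 2) =o[𝓝[>] 0] fun ε => ε := by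
  have h : (fun ε : ℝ => ε ^ 2) =o[𝓝 0] fun ε => ε := by
    simpa using isLittleO_pow_pow (𝕜 := ℝ) one_lt_two
  exact (h.mono nhdsWithin_le_nhds).const_mul_left c

lemma gaussianReal_sq_remainder_isLittleO {F : ℝ → ℝ} (hF : ContDiff ℝ 2 F) (σ a : ℝ)
    {γ : ℝ} (hγ : 0 ≤ γ) {s : ℝ≥0} (hs : s ≠ 0) (hFs : MemLp F 2 (gaussianReal σ s)) :
    (∀ᶠ ε in 𝓝[>] (0 : ℝ), Integrable (fun y => (F y - F σ - deriv F σ * (y - σ)) ^ 2)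
      (gaussianReal (σ + ε * a) (ε * γ).toNNReal)) ∧
    (fun ε : ℝ => ∫ y, (F y - F σ - deriv F σ * (y - σ)) ^ 2
      ∂gaussianReal (σ + ε * a) (ε * γ).toNNReal) =o[𝓝[>] 0] fun ε => ε := by
  have hFm := hF.continuous.measurable
  refine gaussianReal_integral_isLittleO σ a hγ hs (by fun_prop) ?_
    ((isLittleO_taylor_one hF σ).pow two_pos)
  exact ((hFs.sub (memLp_const (F σ))).sub
    (((memLp_id_gaussianReal 2).sub (memLp_const σ)).const_mul (deriv F σ))).integrable_sq

/-- With `R` the first order Taylor remainder, `(F - F σ)² - F'(σ)² (y - σ)² = R² + 2 F'(σ) R (y -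
σ)` is `o((y - σ)²)`, and the second moment about `σ` is exactly `ε γ + ε² a²`. -/
lemma gaussianReal_sq_sub_expansion {F : ℝ → ℝ} (hF : ContDiff ℝ 2 F) (σ a : ℝ)
    {γ : ℝ} (hγ : 0 ≤ γ) {s : ℝ≥0} (hs : s ≠ 0) (hFs : MemLp F 2 (gaussianReal σ s)) :
    (∀ᶠ ε in 𝓝[>] (0 : ℝ), MemLp F 2 (gaussianReal (σ + ε * a) (ε * γ).toNNReal)) ∧
    (fun ε : ℝ => (∫ y, (F y - F σ) ^ 2 ∂gaussianReal (σ + ε * a) (ε * γ).toNNReal)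
      - ε * (deriv F σ ^ 2 * γ)) =o[𝓝[>] 0] fun ε => ε := by
  have hFm := hF.continuous.measurable
  obtain ⟨h1, h2⟩ := gaussianReal_integral_isLittleO σ a hγ hs
    (H := fun y => (F y - F σ) ^ 2 - deriv F σ ^ 2 * (y - σ) ^ 2) (by fun_prop)
    ((hFs.sub (memLp_const (F σ))).integrable_sq.sub
      ((integrable_sq_sub_gaussianReal _ _ _).const_mul _)) (by
    have e1 := isLittleO_taylor_one hF σ
    have e2 := ((e1.mul_isBigO (isBigO_refl (fun y => y - σ) (𝓝 σ))).const_mul_left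
      (2 * deriv F σ)).congr_right (g₂ := fun y => (y - σ) ^ 2) fun y => (sq _).symm
    refine ((e1.pow two_pos).add e2).congr_left fun y => ?_
    ring)
  have hi : ∀ᶠ ε in 𝓝[>] (0 : ℝ), Integrable (fun y => (F y - F σ) ^ 2)
      (gaussianReal (σ + ε * a) (ε * γ).toNNReal) := by
    filter_upwards [h1] with ε hε
    refine (hε.add ((integrable_sq_sub_gaussianReal (σ + ε * a) σ (ε * γ).toNNReal).const_mul
      (deriv F σ ^ 2))).congr (Eventually.of_forall fun y => ?_)
    simp
  refine ⟨?_, ?_⟩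
  · filter_upwards [hi] with ε hε
    have h3 : MemLp (fun y => F y - F σ) 2 (gaussianReal (σ + ε * a) (ε * γ).toNNReal) :=
      (memLp_two_iff_integrable_sq (by fun_prop)).2 hε
    refine (h3.add (memLp_const (F σ))).ae_eq (Eventually.of_forall fun y => ?_)
    simp
  · refine (h2.add (isLittleO_const_mul_sq (deriv F σ ^ 2 * a ^ 2))).congr' ?_ EventuallyEq.rfl
    filter_upwards [hi, self_mem_nhdsWithin] with ε hε h4
    have h4' : 0 < ε := h4
    rw [integral_sub hε ((integrable_sq_sub_gaussianReal _ _ _).const_mul _),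
      integral_const_mul, integral_sq_sub_gaussianReal, Real.coe_toNNReal _ (by positivity)]
    ring

lemma gaussianReal_sub_expansion {F : ℝ → ℝ} (hF : ContDiff ℝ 2 F) (σ a : ℝ)
    {γ : ℝ} (hγ : 0 ≤ γ) {s : ℝ≥0} (hs : s ≠ 0) (hFs : MemLp F 2 (gaussianReal σ s)) :
    (fun ε : ℝ => (∫ y, (F y - F σ) ∂gaussianReal (σ + ε * a) (ε * γ).toNNReal)
      - ε * (deriv F σ * a + 1 / 2 * deriv (deriv F) σ * γ)) =o[𝓝[>] 0] fun ε => ε := by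
  have hFm := hF.continuous.measurable
  have hi1 : ∀ m v, Integrable (fun y : ℝ => deriv F σ * (y - σ)) (gaussianReal m v) :=
    fun m v => ((((memLp_id_gaussianReal 2).sub (memLp_const σ)).integrable
      one_le_two).const_mul _)
  have hi2 : ∀ m v, Integrable (fun y : ℝ => 1 / 2 * deriv (deriv F) σ * (y - σ) ^ 2)
      (gaussianReal m v) := fun m v => (integrable_sq_sub_gaussianReal _ _ _).const_mul _
  obtain ⟨-, h2⟩ := gaussianReal_integral_isLittleO σ a hγ hs
    (H := fun y => F y - F σ - deriv F σ * (y - σ) - 1 / 2 * deriv (deriv F) σ * (y - σ) ^ 2)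
    (by fun_prop)
    ((((hFs.sub (memLp_const (F σ))).integrable one_le_two).sub (hi1 _ _)).sub (hi2 _ _))
    (isLittleO_taylor_two hF σ)
  refine (h2.add (isLittleO_const_mul_sq
    (1 / 2 * deriv (deriv F) σ * a ^ 2))).congr' ?_ EventuallyEq.rfl
  filter_upwards [(gaussianReal_sq_sub_expansion hF σ a hγ hs hFs).1, self_mem_nhdsWithin]
    with ε hε h4
  have h4' : 0 < ε := h4
  have hi0 : Integrable (fun y => F y - F σ) (gaussianReal (σ + ε * a) (ε * γ).toNNReal) :=
    (hε.sub (memLp_const (F σ))).integrable one_le_two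
  have i1 := integral_sub hi0 (hi1 (σ + ε * a) (ε * γ).toNNReal)
  have i2 := integral_sub (hi0.sub (hi1 (σ + ε * a) (ε * γ).toNNReal))
    (hi2 (σ + ε * a) (ε * γ).toNNReal)
  simp only [Pi.sub_apply, integral_const_mul, integral_sub_gaussianReal,
    integral_sq_sub_gaussianReal] at i1 i2
  rw [i2, i1, Real.coe_toNNReal _ (by positivity)]
  ring

/-! ### Values at a point, convergence in law, and the perturbed parameter. -/

lemma hasLaw_const_add_const_mul_gaussianReal {Ω' : Type*} [MeasurableSpace Ω'] {Q : Measure Ω'}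
    {G : Ω' → ℝ} (hG : HasLaw G (gaussianReal 0 1) Q) (m c : ℝ) :
    HasLaw (fun ω => m + c * G ω) (gaussianReal m (c ^ 2).toNNReal) Q := by
  have h := gaussianReal_const_add (gaussianReal_const_mul hG c) m
  rw [mul_zero, zero_add, mul_one] at h
  convert h using 2
  exact Real.toNNReal_of_nonneg (sq_nonneg c)

/-- A negative value would persist on a neighbourhood of `x` by continuity, and the law of `X`
charges every such neighbourhood. -/
lemma HasValueAt.nonneg {Ω : Type*} [MeasurableSpace Ω] {P : Measure Ω} {Y X : Ω → ℝ}
    {x y : ℝ} (hX : AEMeasurable X P) (hx : x ∈ (P.map X).support)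
    (h : HasValueAt P Y X x y) (hY : ∀ᵐ ω ∂P, 0 ≤ Y ω) : 0 ≤ y := by
  obtain ⟨f, hfm, hfc, hf, rfl⟩ := h
  by_contra! hneg
  have hU : {z | f z < 0} ∈ 𝓝 x := hfc.eventually_lt_const hneg
  have hpos := (Measure.mem_support_iff_forall x).1 hx _ hU
  rw [Measure.map_apply_of_aemeasurable hX (measurableSet_lt hfm measurable_const)] at hpos
  refine hpos.ne' (measure_eq_zero_iff_ae_notMem.2 ?_)
  filter_upwards [hf, hY] with ω h1 h2
  rw [h1] at h2
  simpa using h2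

/-- A function of `X`, multiplied and shifted along continuous functions of `x₀ + X`. -/
lemma HasValueAt.mul_add_mul {Ω : Type*} [MeasurableSpace Ω] {P : Measure Ω} {Y Z V X : Ω → ℝ}
    {y z x₀ : ℝ} (hY : HasValueAt P Y X 0 y) (hZ : HasValueAt P Z X 0 z) {p q : ℝ → ℝ}
    (hp : Continuous p) (hq : Continuous q)
    (hV : ∀ᵐ ω ∂P, V ω = p (x₀ + X ω) * Y ω + q (x₀ + X ω) * Z ω) :
    HasValueAt P V (fun ω => x₀ + X ω) x₀ (p x₀ * y + q x₀ * z) := by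
  obtain ⟨f, hfm, hfc, hf, rfl⟩ := hY
  obtain ⟨g, hgm, hgc, hg, rfl⟩ := hZ
  have hpm := hp.measurable
  have hqm := hq.measurable
  have hs : ContinuousAt (fun t : ℝ => t - x₀) x₀ := by fun_prop
  refine ⟨fun t => p t * f (t - x₀) + q t * g (t - x₀), by fun_prop, ?_, ?_, by simp⟩
  · exact (hp.continuousAt.mul (ContinuousAt.comp_of_eq hfc hs (sub_self x₀))).add
      (hq.continuousAt.mul (ContinuousAt.comp_of_eq hgc hs (sub_self x₀)))
  · filter_upwards [hf, hg, hV] with ω h1 h2 h3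
    rw [h3, h1, h2]
    simp

/-- Convergence in quadratic mean implies convergence in law. -/
lemma tendstoInDistribution_of_integral_sq {ι Ω' : Type*} [MeasurableSpace Ω'] {Q : Measure Ω'}
    [IsProbabilityMeasure Q] {l : Filter ι} [l.IsCountablyGenerated] {Y : ι → Ω' → ℝ} {Z : Ω' → ℝ}
    (hY : ∀ i, AEMeasurable (Y i) Q) (hZ : AEMeasurable Z Q)
    (hmem : ∀ᶠ i in l, MemLp (fun ω => Y i ω - Z ω) 2 Q)
    (h : Tendsto (fun i => ∫ ω, (Y i ω - Z ω) ^ 2 ∂Q) l (𝓝 0)) :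
    TendstoInDistribution Y l Z (fun _ => Q) Q := by
  refine TendstoInMeasure.tendstoInDistribution_of_aemeasurable ?_ hY hZ
  refine tendstoInMeasure_of_tendsto_eLpNorm (p := 2) two_ne_zero
    (fun i => (hY i).aestronglyMeasurable) hZ.aestronglyMeasurable ?_
  have h2 : Tendsto (fun i => ENNReal.ofReal √(∫ ω, (Y i ω - Z ω) ^ 2 ∂Q)) l (𝓝 0) := by
    have := ENNReal.tendsto_ofReal h.sqrt
    simpa using this
  refine h2.congr' ?_
  filter_upwards [hmem] with i hi
  have e := hi.eLpNorm_eq_integral_rpow_norm two_ne_zero (by simp)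
  change _ = eLpNorm (fun ω => Y i ω - Z ω) 2 Q
  rw [e, Real.sqrt_eq_rpow]
  simp

/-- The effect of a small Gaussian perturbation of the parameter on a function of class `C²`. -/
theorem gaussian_perturbation_expansion {F : ℝ → ℝ} (hF : ContDiff ℝ 2 F) (σ a : ℝ) {γ : ℝ}
    (hγ : 0 ≤ γ) {s : ℝ≥0} (hs : s ≠ 0) (hFs : MemLp F 2 (gaussianReal σ s))
    {Ω' : Type*} [MeasurableSpace Ω'] (Q : Measure Ω') [IsProbabilityMeasure Q]
    {E : Type*} [MeasurableSpace E] (W : Ω' → E)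
    (G : Ω' → ℝ) (hG : HasLaw G (gaussianReal 0 1) Q) (hGW : IndepFun G W Q) :
    (∀ᶠ ε : ℝ in 𝓝[>] 0, MemLp (fun ω => F (σ + ε * a + √(ε * γ) * G ω)) 2 Q) ∧
    (fun ε : ℝ => (∫ ω, (F (σ + ε * a + √(ε * γ) * G ω) - F σ) ∂Q)
      - ε * (deriv F σ * a + 1 / 2 * deriv (deriv F) σ * γ)) =o[𝓝[>] 0] (fun ε : ℝ => ε) ∧
    (fun ε : ℝ => (∫ ω, (F (σ + ε * a + √(ε * γ) * G ω) - F σ) ^ 2 ∂Q)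
      - ε * (deriv F σ ^ 2 * γ)) =o[𝓝[>] 0] (fun ε : ℝ => ε) ∧
    (fun ε : ℝ => variance (fun ω => F (σ + ε * a + √(ε * γ) * G ω)) Q
      - ε * (deriv F σ ^ 2 * γ)) =o[𝓝[>] 0] (fun ε : ℝ => ε) ∧
    ∃ G' : Ω' → ℝ, HasLaw G' (gaussianReal 0 1) Q ∧ IndepFun G' W Q ∧
      (∀ ε : ℝ, 0 < ε → HasLaw (fun ω => F σ
          + ε * (deriv F σ * a + 1 / 2 * deriv (deriv F) σ * γ) + √ε * √(deriv F σ ^ 2 * γ) * G' ω)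
        (gaussianReal (F σ + ε * (deriv F σ * a + 1 / 2 * deriv (deriv F) σ * γ))
          (ε * (deriv F σ ^ 2 * γ)).toNNReal) Q) ∧
      (fun ε : ℝ => ∫ ω, (F (σ + ε * a + √(ε * γ) * G ω)
          - (F σ + ε * (deriv F σ * a + 1 / 2 * deriv (deriv F) σ * γ)
            + √ε * √(deriv F σ ^ 2 * γ) * G' ω)) ^ 2 ∂Q)
        =o[𝓝[>] 0] (fun ε : ℝ => ε) ∧
      TendstoInDistribution
        (fun (ε : ℝ) ω => (F (σ + ε * a + √(ε * γ) * G ω) - F σ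
          - ε * (deriv F σ * a + 1 / 2 * deriv (deriv F) σ * γ)) / √ε)
        (𝓝[>] 0) (fun ω => √(deriv F σ ^ 2 * γ) * G' ω) (fun _ => Q) Q := by
  have hFm := hF.continuous.measurable
  have hGm : AEMeasurable G Q := hG.aemeasurable
  set b := deriv F σ * a + 1 / 2 * deriv (deriv F) σ * γ
  have hlaw : ∀ ε : ℝ, 0 < ε → HasLaw (fun ω => σ + ε * a + √(ε * γ) * G ω)
      (gaussianReal (σ + ε * a) (ε * γ).toNNReal) Q := fun ε hε => by
    have h := hasLaw_const_add_const_mul_gaussianReal hG (σ + ε * a) √(ε * γ)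
    rwa [Real.sq_sqrt (by positivity)] at h
  have hcomp : ∀ ε : ℝ, 0 < ε → ∀ H : ℝ → ℝ, Measurable H →
      ∫ ω, H (σ + ε * a + √(ε * γ) * G ω) ∂Q =
        ∫ y, H y ∂gaussianReal (σ + ε * a) (ε * γ).toNNReal := fun ε hε H hH =>
    (hlaw ε hε).integral_comp hH.aestronglyMeasurable
  obtain ⟨e1, e2⟩ := gaussianReal_sq_sub_expansion hF σ a hγ hs hFs
  obtain ⟨e4, e5⟩ := gaussianReal_sq_remainder_isLittleO hF σ a hγ hs hFs
  have hmem : ∀ᶠ ε : ℝ in 𝓝[>] 0, MemLp (fun ω => F (σ + ε * a + √(ε * γ) * G ω)) 2 Q := by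
    filter_upwards [e1, self_mem_nhdsWithin] with ε hε h0
    rw [← (hlaw ε h0).map_eq] at hε
    exact hε.comp_of_map (hlaw ε h0).aemeasurable
  have hmean : (fun ε : ℝ => (∫ ω, (F (σ + ε * a + √(ε * γ) * G ω) - F σ) ∂Q) - ε * b)
      =o[𝓝[>] 0] (fun ε : ℝ => ε) := by
    refine (gaussianReal_sub_expansion hF σ a hγ hs hFs).congr' ?_ EventuallyEq.rfl
    filter_upwards [self_mem_nhdsWithin] with ε h0
    rw [hcomp ε h0 (fun y => F y - F σ) (by fun_prop)]
  have hsq : (fun ε : ℝ => (∫ ω, (F (σ + ε * a + √(ε * γ) * G ω) - F σ) ^ 2 ∂Q)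
      - ε * (deriv F σ ^ 2 * γ)) =o[𝓝[>] 0] (fun ε : ℝ => ε) := by
    refine e2.congr' ?_ EventuallyEq.rfl
    filter_upwards [self_mem_nhdsWithin] with ε h0
    rw [hcomp ε h0 (fun y => (F y - F σ) ^ 2) (by fun_prop)]
  refine ⟨hmem, hmean, hsq, ?_, ?_⟩
  -- The variance is the quadratic error minus the squared bias; the bias is `O(ε)`, so its square
  -- is `o(ε)`.
  · have hO : (fun ε : ℝ => ∫ ω, (F (σ + ε * a + √(ε * γ) * G ω) - F σ) ∂Q)
        =O[𝓝[>] 0] (fun ε : ℝ => ε) := by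
      have h1 : (fun ε : ℝ => ε * b) =O[𝓝[>] 0] (fun ε : ℝ => ε) := by
        simpa [mul_comm] using (isBigO_refl (fun ε : ℝ => ε) (𝓝[>] 0)).const_mul_left b
      simpa using hmean.isBigO.add h1
    have hO2 : (fun ε : ℝ => (∫ ω, (F (σ + ε * a + √(ε * γ) * G ω) - F σ) ∂Q) ^ 2)
        =o[𝓝[>] 0] (fun ε : ℝ => ε) := by
      refine (hO.pow 2).trans_isLittleO ?_
      simpa using isLittleO_const_mul_sq 1
    refine (hsq.sub hO2).congr' ?_ EventuallyEq.rfl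
    filter_upwards [hmem] with ε hε
    have h1 := variance_eq_sub (hε.sub (memLp_const (F σ)))
    have h2 := variance_sub_const hε.1 (F σ)
    change variance (fun ω => F (σ + ε * a + √(ε * γ) * G ω) - F σ) Q = _ at h1
    rw [← h2, h1]
    simp only [Pi.pow_apply, Pi.sub_apply]
    ring
  -- `c` is a sign of `F'(σ)`, equal to `1` or `-1`. Then `G' = c G` is again standard Gaussian and
  -- independent of `W`, and `√(F'(σ)² γ) G' = F'(σ) √γ G`.
  · obtain ⟨c, hc, hcF⟩ : ∃ c : ℝ, c ^ 2 = 1 ∧ |deriv F σ| * c = deriv F σ := by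
      rcases le_total 0 (deriv F σ) with h | h
      · exact ⟨1, by norm_num, by rw [abs_of_nonneg h, mul_one]⟩
      · exact ⟨-1, by norm_num, by rw [abs_of_nonpos h]; ring⟩
    have hG' : HasLaw (fun ω => c * G ω) (gaussianReal 0 1) Q := by
      have h := hasLaw_const_add_const_mul_gaussianReal hG 0 c
      simpa [hc] using h
    have hsqrt : √(deriv F σ ^ 2 * γ) = |deriv F σ| * √γ := by
      rw [Real.sqrt_mul (sq_nonneg _), Real.sqrt_sq_eq_abs]
    -- The Gaussian terms cancel, leaving the first order Taylor remainder and a deterministic term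
    -- of order `ε`.
    have hdiff : ∀ ε : ℝ, 0 < ε → ∀ ω, F (σ + ε * a + √(ε * γ) * G ω)
        - (F σ + ε * b + √ε * √(deriv F σ ^ 2 * γ) * (c * G ω)) =
        (F (σ + ε * a + √(ε * γ) * G ω) - F σ
          - deriv F σ * ((σ + ε * a + √(ε * γ) * G ω) - σ)) + ε * (deriv F σ * a - b) := by
      intro ε hε ω
      rw [hsqrt, Real.sqrt_mul hε.le]
      linear_combination (-(√ε * √γ * G ω)) * hcF
    have hrem : ∀ᶠ ε : ℝ in 𝓝[>] 0, MemLp (fun ω => F (σ + ε * a + √(ε * γ) * G ω) - F σ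
          - deriv F σ * ((σ + ε * a + √(ε * γ) * G ω) - σ)) 2 Q := by
      filter_upwards [e4, self_mem_nhdsWithin] with ε hε h0
      have h1 := (memLp_two_iff_integrable_sq (by fun_prop)).2 hε
      rw [← (hlaw ε h0).map_eq] at h1
      exact h1.comp_of_map (hlaw ε h0).aemeasurable
    have hL2 : (fun ε : ℝ => ∫ ω, (F (σ + ε * a + √(ε * γ) * G ω)
          - (F σ + ε * b + √ε * √(deriv F σ ^ 2 * γ) * (c * G ω))) ^ 2 ∂Q)
        =o[𝓝[>] 0] (fun ε : ℝ => ε) := by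
      have hbound : (fun ε : ℝ => 2 * (∫ y, (F y - F σ - deriv F σ * (y - σ)) ^ 2
          ∂gaussianReal (σ + ε * a) (ε * γ).toNNReal) + 2 * (deriv F σ * a - b) ^ 2 * ε ^ 2)
          =o[𝓝[>] 0] (fun ε : ℝ => ε) :=
        (e5.const_mul_left 2).add (isLittleO_const_mul_sq _)
      refine IsBigO.trans_isLittleO (IsBigO.of_bound 1 ?_) hbound
      filter_upwards [hrem, self_mem_nhdsWithin] with ε hε h0
      rw [← hcomp ε h0 (fun y => (F y - F σ - deriv F σ * (y - σ)) ^ 2) (by fun_prop), one_mul,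
        Real.norm_of_nonneg (integral_nonneg fun _ => sq_nonneg _)]
      refine le_trans ?_ (Real.le_norm_self _)
      simp only [hdiff ε h0]
      have i1 := (hε.add (memLp_const (ε * (deriv F σ * a - b)))).integrable_sq
      have i2 := (hε.integrable_sq.const_mul 2).add
        (integrable_const (2 * (deriv F σ * a - b) ^ 2 * ε ^ 2))
      have i3 := integral_add (hε.integrable_sq.const_mul 2)
        (integrable_const (2 * (deriv F σ * a - b) ^ 2 * ε ^ 2))
      rw [integral_const_mul, integral_const, probReal_univ, one_smul] at i3
      rw [← i3]
      refine integral_mono i1 i2 fun ω => ?_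
      beta_reduce
      nlinarith [sq_nonneg ((F (σ + ε * a + √(ε * γ) * G ω) - F σ
          - deriv F σ * ((σ + ε * a + √(ε * γ) * G ω) - σ)) - ε * (deriv F σ * a - b))]
    refine ⟨fun ω => c * G ω, hG', hGW.comp (measurable_const_mul c) measurable_id, fun ε hε => ?_,
      hL2, ?_⟩
    · have h := hasLaw_const_add_const_mul_gaussianReal hG' (F σ + ε * b) (√ε * √(deriv F σ ^ 2 * γ))
      rwa [mul_pow, Real.sq_sqrt hε.le, Real.sq_sqrt (by positivity)] at h
    · have hscale : ∀ ε : ℝ, 0 < ε → ∀ ω, (F (σ + ε * a + √(ε * γ) * G ω) - F σ - ε * b) / √ε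
          - √(deriv F σ ^ 2 * γ) * (c * G ω) = (√ε)⁻¹ * (F (σ + ε * a + √(ε * γ) * G ω)
          - (F σ + ε * b + √ε * √(deriv F σ ^ 2 * γ) * (c * G ω))) := by
        intro ε hε ω
        have : √ε ≠ 0 := (Real.sqrt_pos.2 hε).ne'
        field_simp
        ring
      refine tendstoInDistribution_of_integral_sq (fun ε => by fun_prop) (by fun_prop) ?_ ?_
      · filter_upwards [hrem, self_mem_nhdsWithin] with ε hε h0
        simp only [hscale ε h0, hdiff ε h0]
        exact (hε.add (memLp_const _)).const_mul _
      · have hne : ∀ᶠ ε : ℝ in 𝓝[>] 0, ε = 0 → (∫ ω, (F (σ + ε * a + √(ε * γ) * G ω)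
            - (F σ + ε * b + √ε * √(deriv F σ ^ 2 * γ) * (c * G ω))) ^ 2 ∂Q) = 0 := by
          filter_upwards [self_mem_nhdsWithin] with ε h0 h1
          exact absurd h1 (ne_of_gt h0)
        refine ((isLittleO_iff_tendsto' hne).1 hL2).congr' ?_
        filter_upwards [self_mem_nhdsWithin] with ε h0
        simp only [hscale ε h0, mul_pow]
        rw [integral_const_mul, inv_pow, Real.sq_sqrt (le_of_lt h0), div_eq_inv_mul]

theorem mainTheorem5
    -- the error structure, and the error `X` on the parameter, in the domain of the generator
    {Ω : Type*} [MeasurableSpace Ω] {P : Measure Ω} [IsProbabilityMeasure P]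
    (S : ErrorStructure P) (X : S.D) (hX : (X : Lp ℝ 2 P) ∈ S.generator.domain)
    -- `Γ[X]` and `A[X]` are functions of `X`, continuous at zero, with values `γ₀` and `a₀` there
    (hsupp : (0 : ℝ) ∈ (P.map (X : Lp ℝ 2 P)).support)
    (γ₀ a₀ : ℝ)
    (hγ₀ : HasValueAt P (S.Γ X X) (X : Lp ℝ 2 P) 0 γ₀)
    (ha₀ : HasValueAt P (S.generator ⟨X, hX⟩) (X : Lp ℝ 2 P) 0 a₀)
    -- the function `F` of the parameter `σ = σ₀ + X`, and the integrability of the quantities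
    -- that appear in the chain rules
    (F : ℝ → ℝ) (hF : ContDiff ℝ 2 F) (σ₀ : ℝ)
    (hF0 : MemLp (fun ω => F (σ₀ + (X : Lp ℝ 2 P) ω)) 2 P)
    (hF1 : MemLp (fun ω => deriv F (σ₀ + (X : Lp ℝ 2 P) ω) ^ 2 * S.Γ X X ω) 1 P)
    (hF2 : MemLp (fun ω => deriv F (σ₀ + (X : Lp ℝ 2 P) ω) * S.generator ⟨X, hX⟩ ω
      + 1 / 2 * deriv (deriv F) (σ₀ + (X : Lp ℝ 2 P) ω) * S.Γ X X ω) 2 P)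
    -- `F` is square integrable for some nondegenerate Gaussian law centred at `σ₀`
    (hFgauss : ∃ s : ℝ≥0, s ≠ 0 ∧ MemLp F 2 (gaussianReal σ₀ s))
    -- the exogenous standard Gaussian variable `G`, independent of all other random quantities `W`
    {Ω' : Type*} [MeasurableSpace Ω'] (Q : Measure Ω') [IsProbabilityMeasure Q]
    {E : Type*} [MeasurableSpace E] (W : Ω' → E)
    (G : Ω' → ℝ) (hG : HasLaw G (gaussianReal 0 1) Q) (hGW : IndepFun G W Q) :
    -- `F(σ)` belongs to the domain of the generator, and satisfies the chain rules
    ∃ (Fσ : S.D) (hFσ : (Fσ : Lp ℝ 2 P) ∈ S.generator.domain),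
      (∀ᵐ ω ∂P, (Fσ : Lp ℝ 2 P) ω = F (σ₀ + (X : Lp ℝ 2 P) ω)) ∧
      (∀ᵐ ω ∂P, S.Γ Fσ Fσ ω = deriv F (σ₀ + (X : Lp ℝ 2 P) ω) ^ 2 * S.Γ X X ω) ∧
      (∀ᵐ ω ∂P, S.generator ⟨Fσ, hFσ⟩ ω =
        deriv F (σ₀ + (X : Lp ℝ 2 P) ω) * S.generator ⟨X, hX⟩ ω
          + 1 / 2 * deriv (deriv F) (σ₀ + (X : Lp ℝ 2 P) ω) * S.Γ X X ω) ∧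
      -- `g = Γ[F(σ)](σ₀)` and `b = A[F(σ)](σ₀)`
      ∃ g b : ℝ,
        HasValueAt P (S.Γ Fσ Fσ) (fun ω => σ₀ + (X : Lp ℝ 2 P) ω) σ₀ g ∧
        HasValueAt P (S.generator ⟨Fσ, hFσ⟩) (fun ω => σ₀ + (X : Lp ℝ 2 P) ω) σ₀ b ∧
        0 ≤ γ₀ ∧
        g = deriv F σ₀ ^ 2 * γ₀ ∧
        b = deriv F σ₀ * a₀ + 1 / 2 * deriv (deriv F) σ₀ * γ₀ ∧
        -- the constant `F(σ₀)` turns into the random variable `F(σ₀ + ε a₀ + √(ε γ₀) G)`, whose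
        -- bias is `ε b + o(ε)`, and whose quadratic error and variance are `ε g + o(ε)`
        (∀ᶠ ε : ℝ in 𝓝[>] 0, MemLp (fun ω => F (σ₀ + ε * a₀ + √(ε * γ₀) * G ω)) 2 Q) ∧
        (fun ε : ℝ => (∫ ω, (F (σ₀ + ε * a₀ + √(ε * γ₀) * G ω) - F σ₀) ∂Q) - ε * b)
          =o[𝓝[>] 0] (fun ε : ℝ => ε) ∧
        (fun ε : ℝ => (∫ ω, (F (σ₀ + ε * a₀ + √(ε * γ₀) * G ω) - F σ₀) ^ 2 ∂Q) - ε * g)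
          =o[𝓝[>] 0] (fun ε : ℝ => ε) ∧
        (fun ε : ℝ => variance (fun ω => F (σ₀ + ε * a₀ + √(ε * γ₀) * G ω)) Q - ε * g)
          =o[𝓝[>] 0] (fun ε : ℝ => ε) ∧
        -- the Gaussian variable `F(σ₀) + ε b + √ε √g G'` approximates it in quadratic mean up to
        -- `o(ε)`, and in law at the scale `√ε`
        ∃ G' : Ω' → ℝ, HasLaw G' (gaussianReal 0 1) Q ∧ IndepFun G' W Q ∧
          (∀ ε : ℝ, 0 < ε → HasLaw (fun ω => F σ₀ + ε * b + √ε * √g * G' ω)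
            (gaussianReal (F σ₀ + ε * b) (ε * g).toNNReal) Q) ∧
          (fun ε : ℝ => ∫ ω, (F (σ₀ + ε * a₀ + √(ε * γ₀) * G ω)
              - (F σ₀ + ε * b + √ε * √g * G' ω)) ^ 2 ∂Q)
            =o[𝓝[>] 0] (fun ε : ℝ => ε) ∧
          TendstoInDistribution
            (fun (ε : ℝ) ω => (F (σ₀ + ε * a₀ + √(ε * γ₀) * G ω) - F σ₀ - ε * b) / √ε)
            (𝓝[>] 0) (fun ω => √g * G' ω) (fun _ => Q) Q := by
  have hXm : AEMeasurable (X : Lp ℝ 2 P) P := (Lp.memLp (X : Lp ℝ 2 P)).1.aemeasurable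
  have hγ : 0 ≤ γ₀ := hγ₀.nonneg hXm hsupp (S.nonneg X)
  obtain ⟨s, hs, hFs⟩ := hFgauss
  -- The calculus is applied to `X` with the translate `x ↦ F (σ₀ + x)`, so that `σ` itself need not
  -- be treated as an element of `𝔻`.
  have hd1 : ∀ x, deriv (fun x => F (σ₀ + x)) x = deriv F (σ₀ + x) := fun x =>
    deriv_comp_const_add F σ₀ x
  have hd2 : ∀ x, deriv (deriv (fun x => F (σ₀ + x))) x = deriv (deriv F) (σ₀ + x) := fun x => by
    rw [funext hd1]
    exact deriv_comp_const_add (deriv F) σ₀ x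
  have hFt : ContDiff ℝ 2 (fun x => F (σ₀ + x)) := hF.comp (contDiff_const.add contDiff_id)
  have hF' : ContDiff ℝ 1 (deriv F) := ((contDiff_succ_iff_deriv (n := 1)).1 hF).2.2
  obtain ⟨w, hw, hwΓ⟩ := S.exists_comp (hFt.of_le one_le_two) X hF0 (by
    simp only [hd1]
    exact memLp_one_iff_integrable.1 hF1)
  have hgraph : ((X : Lp ℝ 2 P), S.generator ⟨X, hX⟩) ∈ S.generatorGraph :=
    (S.mem_generatorGraph_iff _ _).2 ⟨hX, rfl⟩
  obtain ⟨hwD, hwA⟩ := (S.mem_generatorGraph_iff _ _).1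
    (S.comp_mem_generatorGraph hFt X _ hF2.toLp hgraph w hwΓ (by
      simp only [hd1, hd2]
      exact hF2.coeFn_toLp))
  simp only [hd1] at hwΓ
  have hΓw : ∀ᵐ ω ∂P, S.Γ w w ω = deriv F (σ₀ + (X : Lp ℝ 2 P) ω) ^ 2 * S.Γ X X ω := by
    have e := hwΓ X
    rw [S.symm w X] at e
    filter_upwards [hwΓ w, e] with ω h1 h2
    rw [h1, h2]
    ring
  have hAw : ∀ᵐ ω ∂P, S.generator ⟨w, hwD⟩ ω =
      deriv F (σ₀ + (X : Lp ℝ 2 P) ω) * S.generator ⟨X, hX⟩ ω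
        + 1 / 2 * deriv (deriv F) (σ₀ + (X : Lp ℝ 2 P) ω) * S.Γ X X ω := by
    rw [hwA]
    exact hF2.coeFn_toLp
  have hg : HasValueAt P (S.Γ w w) (fun ω => σ₀ + (X : Lp ℝ 2 P) ω) σ₀ (deriv F σ₀ ^ 2 * γ₀) := by
    have := hγ₀.mul_add_mul (V := S.Γ w w) (x₀ := σ₀) hγ₀ (p := fun t => deriv F t ^ 2)
      (q := fun _ => 0) (hF'.continuous.pow 2) continuous_const (by
        filter_upwards [hΓw] with ω h
        rw [h]
        ring)
    simpa using this
  have hb := ha₀.mul_add_mul (V := S.generator ⟨w, hwD⟩) (x₀ := σ₀) hγ₀ (p := deriv F)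
      (q := fun t => 1 / 2 * deriv (deriv F) t) hF'.continuous
      (continuous_const.mul (hF'.continuous_deriv le_rfl)) hAw
  refine ⟨w, hwD, hw, hΓw, hAw, _, _, hg, hb, hγ, rfl, rfl, ?_⟩
  exact gaussian_perturbation_expansion hF σ₀ a₀ hγ hs hFs Q W G hG hGW
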